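/- **Notation.** For an integer $N\ge 1$ let $\Sigma_N=\{0,\dots,N-1\}$, give $\Sigma_N^{\mathbb Z}$ the product topology, and for $x\in\Sigma_N^{\mathbb Z}$ put $\mathrm{real}_N(x)=\sum_{i\in\mathbb Z}x[-i]N^i\in[0,\infty]$. A dynamical system $(X,T)$ is a compact metrizable space $X$ with a continuous map $T:X\to X$; $(Y,S)$ is a factor of $(X,T)$ via $\psi$ if both are dynamical systems and $\psi:X\to Y$ is a continuous surjection with $\psi\circ T=S\circ\psi$. *Multiplication automata.* If $N=pq$ with positive integers $p,q$, let $\mathrm{Mul}_{p,N}:\Sigma_N^{\mathbb Z}\to\Sigma_N^{\mathbb Z}$ be given by $\mathrm{Mul}_{p,N}(x)[i]=a_0p+b_1$, where $x[i]=a_1q+a_0$, $x[i+1]=b_1q+b_0$ with $0\le a_0,b_0<q$ and $0\le a_1,b_1<p$. These maps are commuting bijections. For real $\alpha>0$ the map $\mathrm{Mul}_{\alpha,N}$ is defined if $\alpha=\prod_i p_i/\prod_j q_j$ for finite families of divisors $p_i,q_j$ of $N$, and it is then the composition of all $\mathrm{Mul}_{p_i,N}$ and all $\mathrm{Mul}_{q_j,N}^{-1}$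 (this does not depend on the choice of the $p_i,q_j$). *Multiplication cubes.* For $n\in\mathbb Z_{>0}^d$ and $v\in\mathbb Z^d$ let $m(n,v)=\prod_j n[j]^{-v[j]}$. For $a\in\mathbb N$ and $0\ge v\ge w$ in $\mathbb Z^d$ (coordinatewise) let $D_n(a;v,w)=a_1$, where $a=a_0+a_1m(n,v)+a_2m(n,w)$ with $a_0,a_1,a_2\in\mathbb N$, $a_0<m(n,v)$, $a_1<m(n,w)/m(n,v)$. For $0\le a<\prod_j n[j]$ let $\mathrm{cube}_n(a)$ be the function $(v,w)\mapsto D_n(a;v,w)$ on the pairs $v\ge w$ in $\{-1,0\}^d$; write $\mathbf 1=(1,\dots,1)$ and $\mathrm{val}(t)=t[0,-\mathbf 1]$. Let $X_n$ be the set of maps $f$ from $\mathbb Z^d$ to these cubes with $f[z][0,-\mathbf 1+e_i]=f[z+e_i][-e_i,-\mathbf 1]$ for all $z,i$. For $f\in X_n$ let $(p,p')f$ be the sum, over the steps of any lattice path from $p$ to $p'$, of $m(n,z)\,f[z][0,-e_i]$ for a step $z-e_i\to z$ and of $-m(n,z)\,f[z][0,-e_i]$ for a step $z\to z-e_i$ (it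 is independent of the path), and let $\lambda_n(f;p,p')=(p,p')f/m(n,p')$. *Maps between tessellations and configurations.* Let $N=\prod_j n[j]$. For $x\in\Sigma_N^{\mathbb Z}$ put $\mathrm{tess}_n(x)[z]=\mathrm{cube}_n(\mathrm{Mul}_{\alpha,N}(x)[0])$ with $\alpha=\prod_j n[j]^{z[j]}$, and for $f\in X_n$ put $\mathrm{diag}_n(f)[i]=\mathrm{val}(f[(i,\dots,i)])$. For a $d\times d'$ matrix $A$ over $\mathbb N$ let $n^A=(m(n,-Ae_i))_{i=1}^{d'}$ and, for $f\in X_n$, $\mathrm{macro}_{A,n}(f)[v]=\mathrm{cube}_{n^A}(\lambda_n(f;A(v-\mathbf 1),Av))$, an element of $X_{n^A}$. If no row of $A$ is zero and $f\in X_{n^A}$, let $\mathrm{micro}_{A,n}(f)[x]=\mathrm{cube}_n(D_n(\lambda_{n^A}(f;z_2,z_1);-v,-v-\mathbf 1))$ for any $z_1\ge z_2$ in $\mathbb Z^{d'}$ with $v=Az_1-x\ge0$ and $x-\mathbf 1\ge Az_2$ (it does not depend on $z_1,z_2$, and $\mathrm{micro}_{A,n}(f)\in X_n$). *The maps $\mathrm{conj}$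 and $\mathrm{fact}$.* For $N>1$ with prime factorization $N=\prod_{i=1}^d p_i^{k_i}$, $p_1<\dots<p_d$, let $\mathrm{rad}(N)=\prod_i p_i$, $m=(p_1,\dots,p_d)$, $n=(p_1^{k_1},\dots,p_d^{k_d})$, $A_N=\mathrm{diag}(k_1,\dots,k_d)$, and $\mathrm{conj}_{N,\mathrm{rad}(N)}=\mathrm{diag}_m\circ\mathrm{micro}_{A_N,m}\circ\mathrm{tess}_n$, a bijection. If $N,N'>1$ have the same prime factors and $M=\mathrm{rad}(N)$, let $\mathrm{conj}_{N,N'}=\mathrm{conj}_{N',M}^{-1}\circ\mathrm{conj}_{N,M}$. If $M=p_1\cdots p_d$ with primes $p_1<\dots<p_d$ and $M'=p_{k_1}\cdots p_{k_{d'}}>1$ with $k_1<\dots<k_{d'}$, let $m=(p_1,\dots,p_d)$, $m'=(p_{k_1},\dots,p_{k_{d'}})$, let $A$ be the $d\times d'$ matrix with $i$-th column $e_{k_i}$, and $\mathrm{fact}_{M,M'}=\mathrm{diag}_{m'}\circ\mathrm{macro}_{A,m}\circ\mathrm{tess}_m$. For $N,N'>1$ such that every prime factor of $N'$ divides $N$,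 put $M=\mathrm{rad}(N)$, $M'=\mathrm{rad}(N')$ and $\mathrm{fact}_{N,N'}=\mathrm{conj}_{M',N'}\circ\mathrm{fact}_{M,M'}\circ\mathrm{conj}_{N,M}$. **Statement.** Let $N_1,N_2>1$ be integers such that every prime factor of $N_2$ is a prime factor of $N_1$. Then for every real $\alpha>0$ such that $\mathrm{Mul}_{\alpha,N_1}$ and $\mathrm{Mul}_{\alpha,N_2}$ are defined, the dynamical system $(\Sigma_{N_1}^{\mathbb Z},\mathrm{Mul}_{\alpha,N_1})$ has $(\Sigma_{N_2}^{\mathbb Z},\mathrm{Mul}_{\alpha,N_2})$ as a factor via $\mathrm{fact}_{N_1,N_2}$. Additionally, if $x\in\Sigma_{N_1}^{\mathbb Z}$ is such that $\mathrm{real}_{N_1}(x)$ is finite, then $\mathrm{real}_{N_2}(\mathrm{fact}_{N_1,N_2}(x))=\mathrm{real}_{N_1}(x)$. -/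

import Mathlib

open scoped ENNReal Matrix

noncomputable section

namespace MulCA

/-! ### Topological dynamics -/

/-- `ψ` is a factor map from the topological dynamical system `(X, T)` onto `(Y, S)`; that both
pairs are dynamical systems (continuous self-maps of compact metrizable spaces) is part of it. -/
structure IsFactorMap {X Y : Type*} [TopologicalSpace X] [TopologicalSpace Y]
    (T : X → X) (S : Y → Y) (ψ : X → Y) : Prop where
  compact_source : CompactSpace X
  metrizable_source : TopologicalSpace.MetrizableSpace X
  compact_target : CompactSpace Y
  metrizable_target : TopologicalSpace.MetrizableSpace Y
  continuous_source : Continuous T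
  continuous_target : Continuous S
  continuous_map : Continuous ψ
  equivariant : ψ ∘ T = S ∘ ψ
  surjective : Function.Surjective ψ

/-! ### Configurations and the numbers they represent -/

/-- Bi-infinite sequences over the digits `0, …, N - 1`, with the prodiscrete topology. -/
abbrev Config (N : ℕ) : Type := ℤ → Fin N

/-- `∑_{i ∈ ℤ} x[-i] N ^ i`, an element of `[0, ∞]`. -/
def realOf (N : ℕ) (x : Config N) : ℝ≥0∞ :=
  ∑' i : ℤ, ((x (-i) : ℕ) : ℝ≥0∞) * (N : ℝ≥0∞) ^ i

/-! ### Multiplication automata -/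

/-- The local rule of multiplication by a divisor `p` of `N = p * q`: if `a = a₁ * q + a₀` and
`b = b₁ * q + b₀` with `a₀, b₀ < q`, then the value is `a₀ * p + b₁`. -/
def mulLocal (N p : ℕ) (h : p ∣ N) (a b : Fin N) : Fin N :=
  ⟨(a : ℕ) % (N / p) * p + (b : ℕ) / (N / p), by
    obtain ⟨q, rfl⟩ := h
    have hN : 0 < p * q := lt_of_le_of_lt (Nat.zero_le _) a.2
    have hp : 0 < p := Nat.pos_of_mul_pos_right hN
    have hq : 0 < q := Nat.pos_of_mul_pos_left hN
    rw [Nat.mul_div_cancel_left q hp]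
    have h1 : (a : ℕ) % q + 1 ≤ q := Nat.mod_lt _ hq
    have h2 : (b : ℕ) / q < p := Nat.div_lt_of_lt_mul (by linarith [b.2, mul_comm p q])
    nlinarith [Nat.mul_le_mul_right p h1]⟩

/-- The cellular automaton `Mul_{p,N}` for a divisor `p` of `N`. -/
def mulDvd (N p : ℕ) (h : p ∣ N) (x : Config N) : Config N :=
  fun i => mulLocal N p h (x i) (x (i + 1))

/-- Multiplying by `p` and then by `q`, where `p * q = N`, is the left shift. -/
theorem mulDvd_mulDvd (N p q : ℕ) (hpq : p * q = N) (x : Config N) (i : ℤ) :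
    mulDvd N q ⟨p, by rw [← hpq, mul_comm]⟩ (mulDvd N p ⟨q, hpq.symm⟩ x) i = x (i + 1) := by
  subst hpq
  have hN : 0 < p * q := lt_of_le_of_lt (Nat.zero_le _) (x 0).2
  have hp : 0 < p := Nat.pos_of_mul_pos_right hN
  have hq : 0 < q := Nat.pos_of_mul_pos_left hN
  have h2 (j : ℤ) : (x j : ℕ) / q < p := Nat.div_lt_of_lt_mul (by linarith [(x j).2, mul_comm p q])
  apply Fin.ext
  simp only [mulDvd, mulLocal]
  rw [Nat.mul_div_cancel_left q hp, Nat.mul_div_cancel p hq, Nat.mul_comm (_ % q) p,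
    Nat.mul_add_mod, Nat.mod_eq_of_lt (h2 _), Nat.mul_comm ((x (i + 1) : ℕ) % q) p,
    Nat.mul_add_div hp, Nat.div_eq_of_lt (h2 _)]
  have := Nat.div_add_mod (x (i + 1) : ℕ) q
  linarith [Nat.mul_comm q ((x (i + 1) : ℕ) / q)]

/-- `Mul_{p,N}` as a bijection. -/
def mulPerm (N : ℕ) (p : {p : ℕ // p ∣ N}) : Equiv.Perm (Config N) where
  toFun := mulDvd N p p.2
  invFun x := fun i => mulDvd N (N / p) (Nat.div_dvd_of_dvd p.2) x (i - 1)
  left_inv x := by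
    funext i
    have := mulDvd_mulDvd N p (N / p) (Nat.mul_div_cancel' p.2) x (i - 1)
    simpa using this
  right_inv x := by
    funext i
    have := mulDvd_mulDvd N (N / p) p (Nat.div_mul_cancel p.2) x (i - 1)
    simpa [mulDvd] using this

/-- The composition of the automata `Mul_{p,N}` for `p` in a list of divisors of `N`. -/
def mulList (N : ℕ) (ps : List {p : ℕ // p ∣ N}) : Equiv.Perm (Config N) :=
  (ps.map (mulPerm N)).prod

/-- `F` is an automaton multiplying by `α` in base `N`: there are divisors `pᵢ` and `qⱼ` of `N`
such that `α = (∏ pᵢ) / (∏ qⱼ)`, and `F` is the composition of all `Mul_{pᵢ,N}` and of the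
inverses of all `Mul_{qⱼ,N}`. -/
def IsMul (N : ℕ) (α : ℝ) (F : Equiv.Perm (Config N)) : Prop :=
  ∃ ps qs : List {p : ℕ // p ∣ N},
    α = (((ps.map Subtype.val).prod : ℕ) : ℝ) / (((qs.map Subtype.val).prod : ℕ) : ℝ) ∧
      F = mulList N ps * (mulList N qs)⁻¹

/-- `Mul_{α,N}` is defined, that is, `α` is a quotient of products of divisors of `N`. -/
def MulDefined (N : ℕ) (α : ℝ) : Prop := ∃ F, IsMul N α F

open Classical in
/-- The multiplication automaton `Mul_{α,N}`. It does not depend on the choice made here, by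
`IsMul.unique` below. Where `Mul_{α,N}` is not defined, the value is a dummy. -/
def Mul (N : ℕ) (α : ℝ) : Config N → Config N :=
  if h : MulDefined N α then h.choose else id

/-- The number with the base `N` digits `x[i], …, x[i + k]`. -/
def window (N : ℕ) (x : Config N) (i : ℤ) : ℕ → ℕ
  | 0 => x i
  | k + 1 => N * window N x i k + x (i + (k + 1 : ℕ))

theorem window_mulDvd (N p q : ℕ) (hpq : p * q = N) (x : Config N) (i : ℤ) (k : ℕ) :
    window N (mulDvd N p ⟨q, hpq.symm⟩ x) i k = window N x i (k + 1) / q % N ^ (k + 1) := by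
  subst hpq
  have hN : 0 < p * q := lt_of_le_of_lt (Nat.zero_le _) (x 0).2
  have hp : 0 < p := Nat.pos_of_mul_pos_right hN
  have hq : 0 < q := Nat.pos_of_mul_pos_left hN
  have key (w c e M : ℕ) (hM : 0 < M) (hw : w % q = c % q) (he : e < p * q) :
      (p * q * w + e) / q % (p * q * M) = p * q * (w / q % M) + (c % q * p + e / q) := by
    have h1 : (p * q * w + e) / q = p * q * (w / q) + (c % q * p + e / q) := by
      rw [show p * q * w + e = q * (p * w) + e by ring, Nat.mul_add_div hq, ← hw]
      conv_lhs => rw [← Nat.div_add_mod w q]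
      ring
    have h2 : c % q * p + e / q < p * q := by
      have h3 : c % q + 1 ≤ q := Nat.mod_lt _ hq
      have h4 : e / q < p := Nat.div_lt_of_lt_mul (by rw [mul_comm]; exact he)
      nlinarith [Nat.mul_le_mul_right p h3]
    rw [h1, Nat.mod_mul, Nat.mul_add_mod, Nat.mod_eq_of_lt h2, Nat.mul_add_div hN,
      Nat.div_eq_of_lt h2, add_zero, add_comm]
  induction k with
  | zero =>
    have := key (x i) (x i) (x (i + 1)) 1 one_pos rfl (x (i + 1)).2
    rw [Nat.mod_one, mul_zero, zero_add, mul_one] at this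
    simp only [window, mulDvd, mulLocal, Nat.mul_div_cancel_left q hp]
    simpa using this.symm
  | succ k ih =>
    have hw : window (p * q) x i (k + 1) % q = (x (i + (k + 1 : ℕ)) : ℕ) % q := by
      rw [window, show p * q * window (p * q) x i k = q * (p * window (p * q) x i k) by ring,
        Nat.mul_add_mod]
    have := key _ _ _ ((p * q) ^ (k + 1)) (pow_pos hN _) hw (x (i + (k + 1 + 1 : ℕ))).2
    rw [pow_succ' (p * q) (k + 1), window, ih,
      show window (p * q) x i (k + 1 + 1) =
        p * q * window (p * q) x i (k + 1) + x (i + (k + 1 + 1 : ℕ)) from rfl, this]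
    simp only [mulDvd, mulLocal, Nat.mul_div_cancel_left q hp]
    simp [add_assoc]

theorem window_mulList (N : ℕ) (ps : List {p : ℕ // p ∣ N}) (x : Config N) (i : ℤ) (k : ℕ) :
    window N (mulList N ps x) i k =
      window N x i (k + ps.length) / (ps.map fun p => N / p.1).prod % N ^ (k + 1) := by
  have hN : 0 < N := lt_of_le_of_lt (Nat.zero_le _) (x 0).2
  have hlt (y : Config N) (j : ℤ) (m : ℕ) : window N y j m < N ^ (m + 1) := by
    induction m with
    | zero => simp [window]
    | succ m ih =>
      have h1 : window N y j m + 1 ≤ N ^ (m + 1) := ih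
      have h2 := (y (j + (m + 1 : ℕ))).2
      rw [window, pow_succ' N (m + 1)]
      nlinarith [Nat.mul_le_mul_left N h1]
  induction ps generalizing k with
  | nil => simp [mulList, Nat.mod_eq_of_lt (hlt x i k)]
  | cons p ps ih =>
    have h1 : mulList N (p :: ps) x = mulDvd N p p.2 (mulList N ps x) := by
      simp [mulList, mulPerm]
    have h2 : N / p.1 * p.1 = N := Nat.div_mul_cancel p.2
    have h3 := window_mulDvd N p (N / p.1) (Nat.mul_div_cancel' p.2) (mulList N ps x) i k
    rw [h1, h3, ih (k + 1)]
    have h4 : N ^ (k + 1 + 1) = N / p.1 * (N ^ (k + 1) * p.1) := by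
      rw [pow_succ N (k + 1), mul_left_comm, h2]
    rw [h4, Nat.mod_mul_right_div_self, Nat.mod_mul_right_mod, Nat.div_div_eq_div_mul]
    simp only [List.length_cons, List.map_cons, List.prod_cons]
    rw [show k + 1 + ps.length = k + (ps.length + 1) by ring, mul_comm (N / p.1)]

theorem mulList_congr (N : ℕ) (ps qs : List {p : ℕ // p ∣ N})
    (h : (ps.map Subtype.val).prod = (qs.map Subtype.val).prod) :
    mulList N ps = mulList N qs := by
  rcases Nat.eq_zero_or_pos N with rfl | hN
  · exact Equiv.ext fun x => (Fin.elim0 (x 0))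
  have hprod (l : List {p : ℕ // p ∣ N}) :
      (l.map fun p => N / p.1).prod * (l.map Subtype.val).prod = N ^ l.length := by
    induction l with
    | nil => simp
    | cons p l ih =>
      simp only [List.map_cons, List.prod_cons, List.length_cons, pow_succ, ← ih]
      have h2 : N / p.1 * p.1 = N := Nat.div_mul_cancel p.2
      rw [mul_mul_mul_comm, h2, mul_comm]
  have hshift (y : Config N) (j : ℤ) (m r : ℕ) :
      window N y j (m + r) / N ^ r = window N y j m := by
    induction r with
    | zero => simp
    | succ r ih =>
      rw [pow_succ', ← Nat.div_div_eq_div_mul, ← add_assoc, window, Nat.mul_add_div hN,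
        Nat.div_eq_of_lt (y _).2, add_zero, ih]
  have main (l l' : List {p : ℕ // p ∣ N}) (x : Config N) (i : ℤ) :
      window N (mulList N l x) i 0 = window N x i (l.length + l'.length) /
        ((l.map fun p => N / p.1).prod * N ^ l'.length) % N := by
    rw [window_mulList, mul_comm, ← Nat.div_div_eq_div_mul, hshift]
    simp
  refine Equiv.ext fun x => funext fun i => Fin.ext ?_
  have h1 := main ps qs x i
  have h2 := main qs ps x i
  have h3 : 0 < (ps.map Subtype.val).prod :=
    Nat.pos_of_ne_zero fun h0 => by
      have := hprod ps
      rw [h0, mul_zero] at this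
      exact (pow_pos hN _).ne this
  have h4 : (ps.map fun p => N / p.1).prod * N ^ qs.length =
      (qs.map fun p => N / p.1).prod * N ^ ps.length := by
    rw [← hprod ps, ← hprod qs, h]; ring
  rw [h4, add_comm, ← h2] at h1
  exact h1

theorem IsMul.unique {N : ℕ} {α : ℝ} {F G : Equiv.Perm (Config N)}
    (hF : IsMul N α F) (hG : IsMul N α G) : F = G := by
  rcases Nat.eq_zero_or_pos N with rfl | hN
  · exact Equiv.ext fun x => (Fin.elim0 (x 0))
  obtain ⟨ps, qs, h1, rfl⟩ := hF
  obtain ⟨rs, ss, h2, rfl⟩ := hG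
  have hne (l : List {p : ℕ // p ∣ N}) : (((l.map Subtype.val).prod : ℕ) : ℝ) ≠ 0 := by
    rw [Nat.cast_ne_zero]
    refine List.prod_ne_zero fun h0 => ?_
    obtain ⟨p, -, hp⟩ := List.mem_map.1 h0
    exact hN.ne' (Nat.eq_zero_of_zero_dvd (hp ▸ p.2))
  rw [h1, div_eq_div_iff (hne qs) (hne ss)] at h2
  have happ (l l' : List {p : ℕ // p ∣ N}) : mulList N (l ++ l') = mulList N l * mulList N l' := by
    simp [mulList]
  have hcomm (l l' : List {p : ℕ // p ∣ N}) : Commute (mulList N l) (mulList N l') := by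
    rw [Commute, SemiconjBy, ← happ, ← happ]
    exact mulList_congr N _ _ (by simp [mul_comm])
  have h3 : mulList N ps * mulList N ss = mulList N rs * mulList N qs := by
    rw [← happ, ← happ]
    exact mulList_congr N _ _ (by simp only [List.map_append, List.prod_append]; exact_mod_cast h2)
  rw [mul_inv_eq_iff_eq_mul, mul_assoc, ← (hcomm ss qs).inv_left.eq.symm, ← mul_assoc,
    ← h3, mul_assoc, mul_inv_cancel, mul_one]

/-! ### Multiplication cubes -/

/-- The standard basis vector `e_i`. -/
def e {d : ℕ} (i : Fin d) : Fin d → ℤ := Pi.single i 1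

/-- The weight `m(n, v) = ∏ n[j] ^ (-v[j])` of the point `v`, for a prebasis `n`. -/
def wgt {d : ℕ} (n : Fin d → ℕ) (v : Fin d → ℤ) : ℚ := ∏ j, (n j : ℚ) ^ (-v j)

/-- The positive integer `m(n, v)` for `v ≤ 0`. -/
def mNat {d : ℕ} (n : Fin d → ℕ) (v : Fin d → ℤ) : ℕ := ∏ j, n j ^ (-v j).toNat

theorem mNat_cast {d : ℕ} (n : Fin d → ℕ) (v : Fin d → ℤ) (hv : v ≤ 0) :
    (mNat n v : ℚ) = wgt n v := by
  simp only [mNat, wgt, Nat.cast_prod, Nat.cast_pow]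
  refine Finset.prod_congr rfl fun j _ => ?_
  have := hv j
  simp only [Pi.zero_apply] at this
  rw [← zpow_natCast, Int.toNat_of_nonneg (by omega)]

/-- The middle digit `a₁` of the mixed base representation `a = a₀ + a₁ m(n, v) + a₂ m(n, w)`,
where `0 ≥ v ≥ w`, `0 ≤ a₀ < m(n, v)` and `0 ≤ a₁ < m(n, w) / m(n, v)`. -/
def midDigit {d : ℕ} (n : Fin d → ℕ) (a : ℕ) (v w : Fin d → ℤ) : ℕ :=
  a / mNat n v % (mNat n w / mNat n v)

theorem midDigit_eq {d : ℕ} (n : Fin d → ℕ) (v w : Fin d → ℤ) (hwv : w ≤ v)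
    (a₀ a₁ a₂ : ℕ) (h₀ : a₀ < mNat n v) (h₁ : a₁ < mNat n w / mNat n v) :
    midDigit n (a₀ + a₁ * mNat n v + a₂ * mNat n w) v w = a₁ := by
  have hd : mNat n v ∣ mNat n w := Finset.prod_dvd_prod_of_dvd _ _ fun j _ =>
    pow_dvd_pow _ (Int.toNat_le_toNat (neg_le_neg (hwv j)))
  obtain ⟨c, hc⟩ := hd
  have hpos : 0 < mNat n v := lt_of_le_of_lt (Nat.zero_le _) h₀
  rw [hc, Nat.mul_div_cancel_left _ hpos] at h₁
  rw [midDigit, hc, Nat.mul_div_cancel_left _ hpos,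
    show a₀ + a₁ * mNat n v + a₂ * (mNat n v * c) = mNat n v * (a₁ + c * a₂) + a₀ by ring,
    Nat.mul_add_div hpos, Nat.div_eq_of_lt h₀, add_zero, Nat.add_mul_mod_self_left,
    Nat.mod_eq_of_lt h₁]

/-- Pairs `(v₁, v₂)` with `v₁ ≥ v₂` in `{-1, 0}^d`; such a pair stands for the hyperface of
`[-1, 0]^d` that it spans. -/
def Face (d : ℕ) : Type :=
  {v : (Fin d → ℤ) × (Fin d → ℤ) //
    (∀ i, v.1 i = -1 ∨ v.1 i = 0) ∧ (∀ i, v.2 i = -1 ∨ v.2 i = 0) ∧ v.2 ≤ v.1}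

/-- The whole cube, `(0, -1)`. -/
def fullFace (d : ℕ) : Face d :=
  ⟨(0, fun _ => -1), fun _ => Or.inr rfl, fun _ => Or.inl rfl, fun _ => by simp⟩

/-- The edge `(0, -e_i)`. -/
def edgeFace {d : ℕ} (i : Fin d) : Face d :=
  ⟨(0, -e i), fun _ => Or.inr rfl, fun j => by
    by_cases h : j = i
    · subst h; left; simp [e]
    · right; simp [e, Pi.single_eq_of_ne h], fun j => by
    by_cases h : j = i
    · subst h; simp [e]
    · simp [e, Pi.single_eq_of_ne h]⟩

/-- A cube with all of its hyperfaces labelled by natural numbers. -/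
abbrev Cube (d : ℕ) : Type := Face d → ℕ

/-- The multiplication cube of the prebasis `n` for `a < ∏ n[i]`. -/
def cube {d : ℕ} (n : Fin d → ℕ) (a : ℕ) : Cube d := fun s => midDigit n a s.1.1 s.1.2

/-- The valuation of a cube: the label of its unique `d`-dimensional hyperface. -/
def val {d : ℕ} (t : Cube d) : ℕ := t (fullFace d)

/-- Arrays of labelled cubes. The maps `macro`, `micro`, `diag` below are applied to valid
tessellations by multiplication cubes only; their defining formulas make sense for all arrays. -/
abbrev Tiling (d : ℕ) : Type := (Fin d → ℤ) → Cube d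

/-! ### Path integrals -/

/-- Neighbours in the grid `ℤ^d`. -/
def Adj {d : ℕ} (p p' : Fin d → ℤ) : Prop := ∃ i, p' = p + e i ∨ p = p' + e i

/-- `P` is a path in the grid from `p` to `p'`. -/
def IsPath {d : ℕ} (P : List (Fin d → ℤ)) (p p' : Fin d → ℤ) : Prop :=
  P.head? = some p ∧ P.getLast? = some p' ∧ P.IsChain Adj

theorem exists_isPath {d : ℕ} (p p' : Fin d → ℤ) : ∃ P, IsPath P p p' := by
  have hstep (i : Fin d) (p : Fin d → ℤ) (c : ℤ) :
      Relation.ReflTransGen Adj p (p + Pi.single i c) := by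
    induction c using Int.induction_on with
    | zero => simpa using Relation.ReflTransGen.refl
    | succ c ih =>
      refine ih.tail ⟨i, Or.inl ?_⟩
      rw [e, Pi.single_add, add_assoc]
    | pred c ih =>
      refine ih.tail ⟨i, Or.inr ?_⟩
      rw [e, add_assoc, ← Pi.single_add, sub_add_cancel]
  have hsum (v : Fin d → ℤ) (s : Finset (Fin d)) :
      Relation.ReflTransGen Adj p (p + ∑ j ∈ s, Pi.single j (v j)) := by
    classical
    induction s using Finset.induction_on with
    | empty => simpa using Relation.ReflTransGen.refl
    | insert j s hj ih =>
      rw [Finset.sum_insert hj, ← add_assoc, add_right_comm]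
      exact ih.trans (hstep j _ _)
  have h := hsum (p' - p) Finset.univ
  rw [Finset.univ_sum_single, add_sub_cancel] at h
  obtain ⟨l, hl, hlast⟩ := List.exists_isChain_cons_of_relationReflTransGen h
  exact ⟨p :: l, rfl, by rw [List.getLast?_eq_some_getLast (List.cons_ne_nil _ _), hlast], hl⟩

/-- The contribution `± wgt(max {p, p'}) * label` of the directed edge from `p` to its neighbour
`p'`, where the grid edge between `z - e_i` and `z` carries the label `(0, -e_i)` of `f[z]`. -/
def edgeInt {d : ℕ} (n : Fin d → ℕ) (f : Tiling d) (p p' : Fin d → ℤ) : ℚ :=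
  ∑ i, if p' = p + e i then wgt n p' * f p' (edgeFace i)
    else if p = p' + e i then -(wgt n p * f p (edgeFace i)) else 0

/-- The integral of `f` over a path. -/
def pathInt {d : ℕ} (n : Fin d → ℕ) (f : Tiling d) : List (Fin d → ℤ) → ℚ
  | [] => 0
  | [_] => 0
  | p :: p' :: P => edgeInt n f p p' + pathInt n f (p' :: P)

/-- The integral of `f` over some path from `p` to `p'`; for valid tessellations by
multiplication cubes the choice of the path does not matter. -/
def integral {d : ℕ} (n : Fin d → ℕ) (f : Tiling d) (p p' : Fin d → ℤ) : ℚ :=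
  pathInt n f (exists_isPath p p').choose

/-- The label of the directed pair `(p, p')`. -/
def lbl {d : ℕ} (n : Fin d → ℕ) (f : Tiling d) (p p' : Fin d → ℤ) : ℚ :=
  integral n f p p' / wgt n p'

/-! ### Macrotiles and microtiles -/

/-- The matrix `A` as a map `ℤ^{d'} → ℤ^d`. -/
def act {d d' : ℕ} (A : Matrix (Fin d) (Fin d') ℕ) (v : Fin d' → ℤ) : Fin d → ℤ :=
  A.map (Nat.cast : ℕ → ℤ) *ᵥ v

/-- The prebasis `n^A`, with entries `m(n, -A e_i) = ∏ n[j] ^ A[j, i]`. -/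
def prePow {d d' : ℕ} (n : Fin d → ℕ) (A : Matrix (Fin d) (Fin d') ℕ) : Fin d' → ℕ :=
  fun i => ∏ j, n j ^ A j i

/-- The macrotile map of `A` from `n`-tessellations to `n^A`-tessellations. The label is a natural
number when `f` is a valid tessellation. -/
def macroMap {d d' : ℕ} (A : Matrix (Fin d) (Fin d') ℕ) (n : Fin d → ℕ) (f : Tiling d) :
    Tiling d' :=
  fun v => cube (prePow n A) ⌊lbl n f (act A (v - 1)) (act A v)⌋₊

open Classical in
/-- The microtile map of `A` (all of whose rows are nonzero) from `n^A`-tessellations to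
`n`-tessellations: choose `z₁ ≥ z₂` with `A z₁ ≥ x` and `x - 1 ≥ A z₂`, let `v = A z₁ - x`, let
`a` be the label of `(z₂, z₁)` in `f`, and take the cube whose value is the middle digit of `a`
with respect to `(-v, -v - 1)`. For valid tessellations the choice does not matter. -/
def microMap {d d' : ℕ} (A : Matrix (Fin d) (Fin d') ℕ) (n : Fin d → ℕ) (f : Tiling d') :
    Tiling d :=
  fun x =>
    if h : ∃ z : (Fin d' → ℤ) × (Fin d' → ℤ), x ≤ act A z.1 ∧ z.2 ≤ z.1 ∧ act A z.2 ≤ x - 1 then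
      cube n (midDigit n ⌊lbl (prePow n A) f h.choose.2 h.choose.1⌋₊
        (-(act A h.choose.1 - x)) (-(act A h.choose.1 - x) - 1))
    else cube n 0

/-! ### Tessellations and configurations -/

/-- The number `α(z, n) = ∏ n[i] ^ z[i]`. -/
def shiftFactor {d : ℕ} (z : Fin d → ℤ) (n : Fin d → ℕ) : ℝ := ∏ i, (n i : ℝ) ^ z i

/-- The tessellation formed from `x`, where `n` is a prebasis with `∏ n[i] = N`. -/
def tess (N : ℕ) {d : ℕ} (n : Fin d → ℕ) (x : Config N) : Tiling d :=
  fun z => cube n (Mul N (shiftFactor z n) x 0 : ℕ)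

/-- The configuration on the main diagonal of `f`, for a tessellation over a prebasis `n` with
`∏ n[i] = N`; the valuations are then smaller than `N`, and reducing them modulo `N` changes
nothing. -/
def diag (N : ℕ) [NeZero N] {d : ℕ} (f : Tiling d) : Config N :=
  fun i => Fin.ofNat N (val (f fun _ => i))

/-! ### The conjugacies and the factor maps -/

/-- The product of the distinct prime factors of `N`. -/
def rad (N : ℕ) : ℕ := ∏ p ∈ N.primeFactors, p

instance (N : ℕ) : NeZero (rad N) :=
  ⟨Finset.prod_ne_zero_iff.2 fun _ hp => (Nat.prime_of_mem_primeFactors hp).ne_zero⟩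

/-- The distinct prime factors of `N` in rising order. -/
def primeVec (N : ℕ) : Fin N.primeFactors.card → ℕ := N.primeFactors.orderEmbOfFin rfl

/-- The prime powers `p_i ^ k_i` in the factorization of `N`, with the `p_i` in rising order. -/
def primePowVec (N : ℕ) : Fin N.primeFactors.card → ℕ :=
  fun i => primeVec N i ^ N.factorization (primeVec N i)

/-- The diagonal matrix of the exponents in the factorization of `N`. -/
def expMatrix (N : ℕ) : Matrix (Fin N.primeFactors.card) (Fin N.primeFactors.card) ℕ :=
  Matrix.diagonal fun i => N.factorization (primeVec N i)

/-- `conj_{N,M}` for `M = rad N`. -/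
def conjRad (N M : ℕ) [NeZero M] (x : Config N) : Config M :=
  diag M (microMap (expMatrix N) (primeVec N) (tess N (primePowVec N) x))

/-- `conj_{N,N'} = conj_{N',M}⁻¹ ∘ conj_{N,M}` for `N` and `N'` with the same prime factors, where
`M = rad N = rad N'`. -/
def conjMap (N N' : ℕ) [NeZero N'] (x : Config N) : Config N' :=
  Function.invFun (conjRad N' (rad N)) (conjRad N (rad N) x)

/-- The matrix whose `i`-th column is `e_k`, where the `i`-th prime factor of `M'` is the `k`-th
prime factor of `M`. -/
def selMatrix (M M' : ℕ) : Matrix (Fin M.primeFactors.card) (Fin M'.primeFactors.card) ℕ :=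
  Matrix.of fun k i => if primeVec M k = primeVec M' i then 1 else 0

/-- `fact_{M,M'}` for squarefree `M` and a divisor `M'` of `M`. -/
def factSqfree (M M' : ℕ) [NeZero M'] (x : Config M) : Config M' :=
  diag M' (macroMap (selMatrix M M') (primeVec M) (tess M (primeVec M) x))

/-- `fact_{N,N'} = conj_{M',N'} ∘ fact_{M,M'} ∘ conj_{N,M}` with `M = rad N` and `M' = rad N'`,
when every prime factor of `N'` is a prime factor of `N`. -/
def factMap (N N' : ℕ) [NeZero N'] (x : Config N) : Config N' :=
  conjMap (rad N') N' (factSqfree (rad N) (rad N') (conjMap N (rad N) x))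

end MulCA

end

namespace MulCA

open Filter Topology

/-! ### Numbers composed of the prime factors of `N` -/

/-! A configuration `x` is read as the digits of a number ξ, infinite if nonzero digits continue
forever to the left. Even then ⌊αξ⌋ mod M makes sense when M is a product of primes dividing N and α
a quotient of such products: write α = N^j / c, so that the residue is (⌊N^j ξ⌋ mod cM) / c; since
cM divides some N^k, only the k digits of `x` ending at position j matter. These residues form `fl N
x`. They obey the two rules of `IsFamily`, which suffice to recover every residue from the base N
digits (`IsFamily.congr`); conversely, any family is realized by a configuration (`exists_config`,
`fl_eq_of_digits`).

In these terms each map is transparent. Multiplication by β replaces α by βα (`fl_Mul`). The edge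
labels of a tessellation are residues, path integrals telescope, and the label of a pair of points
is again a residue (`lbl_eq_fl`); hence macrotiles, microtiles and the diagonal only read off other
residues of the same ξ (`macroMap_tess`, `microMap_tess`). So the factor map rewrites ξ from base N
to base N' (`factMap_apply`), and the family of the image is the restriction of the original one
(`fl_factMap`).

Equivariance follows because scaling commutes with this restriction, and continuity because each
residue depends on finitely many digits. For surjectivity, the finite truncations of a target `y`
are expanded in base N; their images converge to `y`, and the range is compact. For finite ξ, the
truncations of the image in base N' are squeezed between ξ - N'^(-K) and ξ (`realOf_factMap`). -/

/-- Every prime factor of `m` divides `N`. -/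
def Smooth (N m : ℕ) : Prop := ∃ k, m ∣ N ^ k

theorem Smooth.of_dvd {N m : ℕ} (h : m ∣ N) : Smooth N m := ⟨1, by simpa using h⟩

theorem Smooth.self (N : ℕ) : Smooth N N := .of_dvd dvd_rfl

theorem Smooth.one (N : ℕ) : Smooth N 1 := .of_dvd (one_dvd _)

theorem Smooth.mono {N m m' : ℕ} (h : Smooth N m) (h' : m' ∣ m) : Smooth N m' :=
  h.imp fun _ hk => h'.trans hk

theorem Smooth.mul {N m m' : ℕ} (h : Smooth N m) (h' : Smooth N m') : Smooth N (m * m') := by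
  obtain ⟨k, hk⟩ := h
  obtain ⟨l, hl⟩ := h'
  exact ⟨k + l, pow_add N k l ▸ mul_dvd_mul hk hl⟩

theorem Smooth.pow {N m : ℕ} (h : Smooth N m) (k : ℕ) : Smooth N (m ^ k) := by
  induction k with
  | zero => simpa using Smooth.one N
  | succ k ih => exact pow_succ m k ▸ ih.mul h

theorem Smooth.prod {ι : Type*} {N : ℕ} (s : Finset ι) (f : ι → ℕ) (h : ∀ i ∈ s, Smooth N (f i)) :
    Smooth N (∏ i ∈ s, f i) :=
  Finset.prod_induction f (Smooth N) (fun _ _ => Smooth.mul) (Smooth.one N) h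

theorem Smooth.trans {N N' m : ℕ} (h : Smooth N' m) (h' : Smooth N N') : Smooth N m := by
  obtain ⟨k, hk⟩ := h
  exact (h'.pow k).mono hk

theorem Smooth.pos {N m : ℕ} [NeZero N] (h : Smooth N m) : 0 < m := by
  obtain ⟨k, hk⟩ := h
  exact Nat.pos_of_dvd_of_pos hk (pow_pos (NeZero.pos N) k)

theorem Smooth.cast_ne_zero {N m : ℕ} [NeZero N] (h : Smooth N m) : (m : ℚ) ≠ 0 :=
  Nat.cast_ne_zero.2 h.pos.ne'

/-- `α` belongs to the multiplicative group generated by the prime factors of `N`. -/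
def SmoothRat (N : ℕ) (α : ℚ) : Prop := ∃ a b : ℕ, Smooth N a ∧ Smooth N b ∧ α = a / b

theorem Smooth.rat {N m : ℕ} (h : Smooth N m) : SmoothRat N m := ⟨m, 1, h, .one N, by simp⟩

theorem SmoothRat.mul {N : ℕ} {α β : ℚ} (h : SmoothRat N α) (h' : SmoothRat N β) :
    SmoothRat N (α * β) := by
  obtain ⟨a, b, ha, hb, rfl⟩ := h
  obtain ⟨a', b', ha', hb', rfl⟩ := h'
  exact ⟨a * a', b * b', ha.mul ha', hb.mul hb', by push_cast; rw [div_mul_div_comm]⟩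

theorem SmoothRat.inv {N : ℕ} {α : ℚ} (h : SmoothRat N α) : SmoothRat N α⁻¹ := by
  obtain ⟨a, b, ha, hb, rfl⟩ := h
  exact ⟨b, a, hb, ha, inv_div _ _⟩

theorem SmoothRat.div {N : ℕ} {α β : ℚ} (h : SmoothRat N α) (h' : SmoothRat N β) :
    SmoothRat N (α / β) := div_eq_mul_inv α β ▸ h.mul h'.inv

theorem SmoothRat.zpow {N : ℕ} {α : ℚ} (h : SmoothRat N α) (k : ℤ) : SmoothRat N (α ^ k) := by
  have hpow (k : ℕ) : SmoothRat N (α ^ k) := by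
    induction k with
    | zero => simpa using (Smooth.one N).rat
    | succ k ih => exact pow_succ α k ▸ ih.mul h
  cases k with
  | ofNat k => simpa using hpow k
  | negSucc k => simpa [zpow_negSucc] using (hpow (k + 1)).inv

theorem SmoothRat.prod {ι : Type*} {N : ℕ} (s : Finset ι) (f : ι → ℚ)
    (h : ∀ i ∈ s, SmoothRat N (f i)) : SmoothRat N (∏ i ∈ s, f i) :=
  Finset.prod_induction f (SmoothRat N) (fun _ _ => SmoothRat.mul)
    (by simpa using (Smooth.one N).rat) h

theorem SmoothRat.trans {N N' : ℕ} {α : ℚ} (h : SmoothRat N' α) (h' : Smooth N N') :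
    SmoothRat N α := by
  obtain ⟨a, b, ha, hb, rfl⟩ := h
  exact ⟨a, b, ha.trans h', hb.trans h', rfl⟩

theorem SmoothRat.pos {N : ℕ} [NeZero N] {α : ℚ} (h : SmoothRat N α) : 0 < α := by
  obtain ⟨a, b, ha, hb, rfl⟩ := h
  exact div_pos (Nat.cast_pos.2 ha.pos) (Nat.cast_pos.2 hb.pos)

theorem SmoothRat.exists_pow_div {N : ℕ} [NeZero N] {α : ℚ} (h : SmoothRat N α) :
    ∃ (j c : ℕ), Smooth N c ∧ α = (N : ℚ) ^ (j : ℤ) / c := by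
  obtain ⟨a, b, ⟨j, c, hc⟩, hb, rfl⟩ := h
  have hcs : Smooth N c := ⟨j, hc ▸ dvd_mul_left c a⟩
  have has : Smooth N a := ⟨j, hc ▸ dvd_mul_right a c⟩
  refine ⟨j, c * b, hcs.mul hb, ?_⟩
  have := has.cast_ne_zero
  have := hcs.cast_ne_zero
  have := hb.cast_ne_zero
  rw [zpow_natCast, ← Nat.cast_pow, hc]
  push_cast
  field_simp

/-! ### Families of residues of integer parts -/

/-- `Φ α M` behaves like `⌊α * ξ⌋ % M` for a (possibly infinite) number `ξ`. -/
structure IsFamily (N : ℕ) (Φ : ℚ → ℕ → ℕ) : Prop where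
  mod : ∀ {α : ℚ} {M M' : ℕ}, SmoothRat N α → Smooth N M' → M ∣ M' → Φ α M' % M = Φ α M
  div : ∀ {α : ℚ} {c M : ℕ}, SmoothRat N α → Smooth N c → Smooth N M →
    Φ (α / c) M = Φ α (c * M) / c

/-- Fewer admissible primes mean fewer conditions. This is what makes a change of base harmless: the
same residues are read in another base. -/
theorem IsFamily.restrict {N N' : ℕ} {Φ : ℚ → ℕ → ℕ} (h : IsFamily N Φ) (hN : Smooth N N') :
    IsFamily N' Φ where
  mod hα hM := h.mod (hα.trans hN) (hM.trans hN)
  div hα hc hM := h.div (hα.trans hN) (hc.trans hN) (hM.trans hN)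

theorem IsFamily.scale {N : ℕ} {Φ : ℚ → ℕ → ℕ} (h : IsFamily N Φ) {β : ℚ} (hβ : SmoothRat N β) :
    IsFamily N fun α => Φ (β * α) where
  mod hα hM := h.mod (hβ.mul hα) hM
  div hα hc hM := by rw [← mul_div_assoc]; exact h.div (hβ.mul hα) hc hM

theorem IsFamily.lt {N : ℕ} [NeZero N] {Φ : ℚ → ℕ → ℕ} (h : IsFamily N Φ) {α : ℚ} {M : ℕ}
    (hα : SmoothRat N α) (hM : Smooth N M) : Φ α M < M :=
  h.mod hα hM dvd_rfl ▸ Nat.mod_lt _ hM.pos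

/-- Splits off the last digit: `div` gives the quotient by N, `mod` the remainder. All inductions
over blocks of digits rest on it. -/
theorem IsFamily.zpow_succ {N : ℕ} [NeZero N] {Φ : ℚ → ℕ → ℕ} (h : IsFamily N Φ) (j : ℤ) (k : ℕ) :
    Φ ((N : ℚ) ^ j) (N ^ (k + 1)) = N * Φ ((N : ℚ) ^ (j - 1)) (N ^ k) + Φ ((N : ℚ) ^ j) N := by
  have hs := Smooth.self N
  rw [zpow_sub_one₀ hs.cast_ne_zero, ← div_eq_mul_inv, h.div (hs.rat.zpow j) hs (hs.pow k),
    ← pow_succ', ← h.mod (hs.rat.zpow j) (hs.pow (k + 1)) (dvd_pow_self N k.succ_ne_zero),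
    Nat.div_add_mod]

/-- With α = N^j / c and cM dividing N^k, the rule `div` clears the denominator and `mod` enlarges
the modulus to N^k. The numbers j, k, c do not depend on the family, so families can be compared and
limits taken digit by digit. -/
theorem exists_family_formula {N : ℕ} [NeZero N] {α : ℚ} {M : ℕ} (hα : SmoothRat N α)
    (hM : Smooth N M) : ∃ (j : ℤ) (k c : ℕ), ∀ Φ, IsFamily N Φ →
      Φ α M = Φ ((N : ℚ) ^ j) (N ^ k) % (c * M) / c := by
  obtain ⟨j, c, hc, rfl⟩ := hα.exists_pow_div
  obtain ⟨k, hk⟩ := hc.mul hM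
  refine ⟨j, k, c, fun Φ h => ?_⟩
  rw [h.mod ((Smooth.self N).rat.zpow j) ((Smooth.self N).pow k) hk,
    h.div ((Smooth.self N).rat.zpow j) hc hM]

theorem IsFamily.congr {N : ℕ} [NeZero N] {Φ Ψ : ℚ → ℕ → ℕ} (h : IsFamily N Φ) (h' : IsFamily N Ψ)
    (heq : ∀ j : ℤ, Φ ((N : ℚ) ^ j) N = Ψ ((N : ℚ) ^ j) N) {α : ℚ} {M : ℕ} (hα : SmoothRat N α)
    (hM : Smooth N M) : Φ α M = Ψ α M := by
  have key (k : ℕ) (j : ℤ) : Φ ((N : ℚ) ^ j) (N ^ k) = Ψ ((N : ℚ) ^ j) (N ^ k) := by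
    induction k generalizing j with
    | zero =>
      have h1 := h.lt ((Smooth.self N).rat.zpow j) (Smooth.one N)
      have h2 := h'.lt ((Smooth.self N).rat.zpow j) (Smooth.one N)
      rw [pow_zero]
      omega
    | succ k ih => rw [h.zpow_succ, h'.zpow_succ, ih, heq]
  obtain ⟨j, k, c, hf⟩ := exists_family_formula hα hM
  rw [hf Φ h, hf Ψ h', key]

theorem isFamily_floor (N : ℕ) (t : ℚ) : IsFamily N fun α M => ⌊α * t⌋₊ % M where
  mod _ _ h := Nat.mod_mod_of_dvd _ h
  div {α c M} _ _ _ := by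
    rw [div_mul_eq_mul_div, Nat.floor_div_natCast, Nat.mod_mul_right_div_self]

/-! ### The family of a configuration -/

/-- The number with the base `N` digits `x[-K], …, x[K]`, the point being behind `x[0]`. -/
def trunc (N : ℕ) (x : Config N) (K : ℕ) : ℚ := window N x (-K) (2 * K) / (N : ℚ) ^ K

theorem trunc_nonneg (N : ℕ) (x : Config N) (K : ℕ) : 0 ≤ trunc N x K := by
  unfold trunc; positivity

theorem window_div_pow {N : ℕ} [NeZero N] (x : Config N) (j : ℤ) (m r : ℕ) :
    window N x j (m + r) / N ^ r = window N x j m := by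
  induction r with
  | zero => simp
  | succ r ih =>
    rw [pow_succ', ← Nat.div_div_eq_div_mul, ← add_assoc, window, Nat.mul_add_div (NeZero.pos N),
      Nat.div_eq_of_lt (x _).2, add_zero, ih]

theorem window_mod {N : ℕ} (x : Config N) (j : ℤ) (m : ℕ) :
    window N x j m % N = x (j + m) := by
  cases m with
  | zero => simp [window, Nat.mod_eq_of_lt (x j).2]
  | succ m => rw [window, Nat.mul_add_mod, Nat.mod_eq_of_lt (x _).2]

theorem floor_trunc {N : ℕ} [NeZero N] (x : Config N) {j : ℤ} {K : ℕ} (hj : j.natAbs ≤ K) :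
    ⌊(N : ℚ) ^ j * trunc N x K⌋₊ % N = x j := by
  -- Multiplying by N^j moves the point behind x[j]: r digits then lie behind it and m + 1 before
  -- it. Both counts make sense because |j| ≤ K.
  obtain ⟨r, hr⟩ : ∃ r : ℕ, (r : ℤ) = K - j := ⟨(K - j).toNat, by omega⟩
  obtain ⟨m, hm⟩ : ∃ m : ℕ, (m : ℤ) = K + j := ⟨(K + j).toNat, by omega⟩
  have hN : (N : ℚ) ≠ 0 := (Smooth.self N).cast_ne_zero
  have h1 : (N : ℚ) ^ j * trunc N x K = (window N x (-K) (2 * K) : ℚ) / (N ^ r : ℕ) := by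
    rw [trunc, Nat.cast_pow, ← zpow_natCast, ← zpow_natCast, hr, zpow_sub₀ hN]
    field_simp
  rw [h1, Nat.floor_div_natCast, Nat.floor_natCast, show 2 * K = m + r by omega, window_div_pow,
    window_mod, hm, neg_add_cancel_left]

/-- The number `⌊α * ξ⌋ % M`, where `ξ` is the (possibly infinite) number with the digits `x`. -/
noncomputable def fl (N : ℕ) (x : Config N) (α : ℚ) (M : ℕ) : ℕ :=
  Classical.epsilon fun r => ∀ᶠ K in atTop, ⌊α * trunc N x K⌋₊ % M = r

/-- The residue depends on finitely many digits, and these are correct in every long enough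
truncation. This justifies the `epsilon` in `fl`; arguments that are not smooth carry no
information. -/
theorem eventually_fl {N : ℕ} [NeZero N] (x : Config N) {α : ℚ} {M : ℕ} (hα : SmoothRat N α)
    (hM : Smooth N M) : ∀ᶠ K in atTop, ⌊α * trunc N x K⌋₊ % M = fl N x α M := by
  suffices h : ∃ r, ∀ᶠ K in atTop, ⌊α * trunc N x K⌋₊ % M = r from Classical.epsilon_spec h
  have key (k : ℕ) (j : ℤ) :
      ∃ r, ∀ᶠ K in atTop, ⌊(N : ℚ) ^ j * trunc N x K⌋₊ % (N ^ k) = r := by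
    induction k generalizing j with
    | zero => exact ⟨0, by simp [Nat.mod_one]⟩
    | succ k ih =>
      obtain ⟨r, hr⟩ := ih (j - 1)
      refine ⟨N * r + x j, ?_⟩
      filter_upwards [hr, eventually_ge_atTop j.natAbs] with K h1 h2
      rw [(isFamily_floor N (trunc N x K)).zpow_succ j k, h1, floor_trunc x h2]
  obtain ⟨j, k, c, hf⟩ := exists_family_formula hα hM
  obtain ⟨r, hr⟩ := key k j
  refine ⟨r % (c * M) / c, hr.mono fun K hK => ?_⟩
  rw [hf _ (isFamily_floor N (trunc N x K)), hK]

theorem isFamily_fl {N : ℕ} [NeZero N] (x : Config N) : IsFamily N (fl N x) where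
  mod {α M M'} hα hM' hd := by
    obtain ⟨K, h1, h2⟩ := ((eventually_fl x hα hM').and (eventually_fl x hα (hM'.mono hd))).exists
    rw [← h1, ← h2, Nat.mod_mod_of_dvd _ hd]
  div {α c M} hα hc hM := by
    obtain ⟨K, h1, h2⟩ := ((eventually_fl x (hα.div hc.rat) hM).and
      (eventually_fl x hα (hc.mul hM))).exists
    rw [← h1, ← h2]
    exact (isFamily_floor N (trunc N x K)).div hα hc hM

theorem fl_zpow {N : ℕ} [NeZero N] (x : Config N) (j : ℤ) : fl N x ((N : ℚ) ^ j) N = x j := by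
  obtain ⟨K, h1, h2⟩ := ((eventually_fl x ((Smooth.self N).rat.zpow j) (Smooth.self N)).and
    (eventually_ge_atTop j.natAbs)).exists
  rw [← h1, floor_trunc x h2]

/-- The main tool for identifying the image of a map: checking its digits against a family
determines all of its residues. -/
theorem fl_eq_of_digits {N : ℕ} [NeZero N] {Φ : ℚ → ℕ → ℕ} (h : IsFamily N Φ) (x : Config N)
    (hx : ∀ j : ℤ, (x j : ℕ) = Φ ((N : ℚ) ^ j) N) {α : ℚ} {M : ℕ} (hα : SmoothRat N α)
    (hM : Smooth N M) : fl N x α M = Φ α M :=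
  (isFamily_fl x).congr h (fun j => by rw [fl_zpow, hx]) hα hM

theorem exists_config {N : ℕ} [NeZero N] {Φ : ℚ → ℕ → ℕ} (h : IsFamily N Φ) :
    ∃ x : Config N, ∀ j : ℤ, (x j : ℕ) = Φ ((N : ℚ) ^ j) N :=
  ⟨fun j => ⟨Φ ((N : ℚ) ^ j) N, h.lt ((Smooth.self N).rat.zpow j) (Smooth.self N)⟩, fun _ => rfl⟩

theorem continuous_fl {N : ℕ} [NeZero N] {α : ℚ} {M : ℕ} (hα : SmoothRat N α)
    (hM : Smooth N M) : Continuous fun x : Config N => fl N x α M := by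
  have key (k : ℕ) (j : ℤ) : Continuous fun x : Config N => fl N x ((N : ℚ) ^ j) (N ^ k) := by
    induction k generalizing j with
    | zero =>
      have h0 (x : Config N) : fl N x ((N : ℚ) ^ j) (N ^ 0) = 0 := by
        have := (isFamily_fl x).lt ((Smooth.self N).rat.zpow j) (Smooth.one N)
        rw [pow_zero]
        omega
      simpa only [h0] using continuous_const
    | succ k ih =>
      have h1 (x : Config N) := (isFamily_fl x).zpow_succ j k
      simp only [fl_zpow] at h1
      simp only [h1]
      exact (continuous_const.mul (ih (j - 1))).add
        (continuous_of_discreteTopology.comp (continuous_apply j))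
  obtain ⟨j, k, c, hf⟩ := exists_family_formula hα hM
  have h1 (x : Config N) := hf _ (isFamily_fl x)
  simp only [h1]
  exact (continuous_of_discreteTopology (f := fun r : ℕ => r % (c * M) / c)).comp (key k j)

theorem continuous_of_digits {N N' : ℕ} [NeZero N] (F : Config N → Config N') (M : ℤ → ℕ)
    (α : ℤ → ℚ) (hα : ∀ i, SmoothRat N (α i)) (hM : ∀ i, Smooth N (M i))
    (hF : ∀ x i, (F x i : ℕ) = fl N x (α i) (M i)) : Continuous F := by
  refine continuous_pi fun i => ?_
  have h : Continuous fun x => (F x i : ℕ) := by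
    simpa only [hF] using continuous_fl (hα i) (hM i)
  -- Continuity into ℕ descends to the digit alphabet because both are discrete and `Fin.val` is
  -- injective.
  exact (IsLocallyConstant.iff_continuous _).1 <|
    IsLocallyConstant.desc (fun x => F x i) (Fin.val)
      ((IsLocallyConstant.iff_continuous _).2 h) Fin.val_injective

/-! ### Multiplication automata and families -/

/-- Since p N^i = N^(i+1) / q with N = pq, the residue is a quotient by q of the two-digit number N
x[i] + x[i+1] modulo qN. The local rule computes exactly this. -/
theorem mulPerm_apply_eq_fl {N : ℕ} [NeZero N] (p : {p : ℕ // p ∣ N}) (x : Config N) (i : ℤ) :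
    (mulPerm N p x i : ℕ) = fl N x (p.1 * (N : ℚ) ^ i) N := by
  obtain ⟨p, q, hq⟩ := p
  have hs := Smooth.self N
  have hps : Smooth N p := .of_dvd ⟨q, hq⟩
  have hqs : Smooth N q := .of_dvd ⟨p, by rw [hq, mul_comm]⟩
  have hqN : N / p = q := by rw [hq, Nat.mul_div_cancel_left q hps.pos]
  have h1 : (p : ℚ) * (N : ℚ) ^ i = (N : ℚ) ^ (i + 1) / q := by
    have hN : (N : ℚ) = p * q := by exact_mod_cast hq
    rw [zpow_add_one₀ hs.cast_ne_zero, eq_div_iff hqs.cast_ne_zero, mul_right_comm, ← hN, mul_comm]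
  have h2 := (isFamily_fl x).zpow_succ (i + 1) 1
  rw [add_sub_cancel_right, pow_one, fl_zpow, fl_zpow] at h2
  have hdvd : q * N ∣ N ^ (1 + 1) := by
    rw [pow_succ, pow_one]; exact mul_dvd_mul_right ⟨p, by rw [hq, mul_comm]⟩ N
  show (x i : ℕ) % (N / p) * p + (x (i + 1) : ℕ) / (N / p) = _
  rw [h1, (isFamily_fl x).div (hs.rat.zpow _) hqs hs,
    ← (isFamily_fl x).mod (hs.rat.zpow _) (hs.pow _) hdvd, h2, hqN, Nat.mod_mul_right_div_self]
  have h3 : N * (x i : ℕ) + x (i + 1) = q * (p * x i) + x (i + 1) := by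
    nth_rw 1 [hq]; ring
  rw [h3, Nat.mul_add_div hqs.pos]
  have h4 := Nat.div_add_mod (x i : ℕ) q
  -- The high part of x[i] contributes a multiple of pq = N and disappears modulo N.
  have h5 : p * (x i : ℕ) + (x (i + 1) : ℕ) / q =
      ((x i : ℕ) % q * p + (x (i + 1) : ℕ) / q) + N * ((x i : ℕ) / q) := by
    calc p * (x i : ℕ) + (x (i + 1) : ℕ) / q
        = p * (q * ((x i : ℕ) / q) + (x i : ℕ) % q) + (x (i + 1) : ℕ) / q := by rw [h4]
      _ = (x i : ℕ) % q * p + (x (i + 1) : ℕ) / q + p * q * ((x i : ℕ) / q) := by ring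
      _ = _ := by rw [← hq]
  have h6 : (x i : ℕ) % q * p + (x (i + 1) : ℕ) / q < N := by
    have := (mulLocal N p ⟨q, hq⟩ (x i) (x (i + 1))).2
    simpa only [mulLocal, hqN] using this
  rw [h5, Nat.add_mul_mod_self_left, Nat.mod_eq_of_lt h6]

theorem fl_mulPerm {N : ℕ} [NeZero N] (p : {p : ℕ // p ∣ N}) (x : Config N) {α : ℚ} {M : ℕ}
    (hα : SmoothRat N α) (hM : Smooth N M) : fl N (mulPerm N p x) α M = fl N x (p.1 * α) M :=
  fl_eq_of_digits ((isFamily_fl x).scale (Smooth.of_dvd p.2).rat) _ (mulPerm_apply_eq_fl p x) hα hM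

theorem smooth_list_prod {N : ℕ} (ps : List {p : ℕ // p ∣ N}) :
    Smooth N (ps.map Subtype.val).prod := by
  induction ps with
  | nil => exact .one N
  | cons p ps ih =>
    rw [List.map_cons, List.prod_cons]
    exact (Smooth.of_dvd p.2).mul ih

theorem fl_mulList {N : ℕ} [NeZero N] (ps : List {p : ℕ // p ∣ N}) (x : Config N) {α : ℚ} {M : ℕ}
    (hα : SmoothRat N α) (hM : Smooth N M) :
    fl N (mulList N ps x) α M = fl N x (((ps.map Subtype.val).prod : ℕ) * α) M := by
  induction ps generalizing α with
  | nil => simp [mulList]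
  | cons p ps ih =>
    have h1 : mulList N (p :: ps) x = mulPerm N p (mulList N ps x) := by simp [mulList]
    rw [h1, fl_mulPerm _ _ hα hM, ih ((Smooth.of_dvd p.2).rat.mul hα), List.map_cons,
      List.prod_cons]
    push_cast
    ring_nf

theorem exists_list_prod {N m : ℕ} [NeZero N] (h : Smooth N m) :
    ∃ ps : List {p : ℕ // p ∣ N}, (ps.map Subtype.val).prod = m := by
  obtain ⟨k, hk⟩ := h
  have hm : m ≠ 0 := (Smooth.pos (N := N) ⟨k, hk⟩).ne'
  -- The prime factors of m, with multiplicity, are themselves divisors of N.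
  refine ⟨m.primeFactorsList.pmap (fun p hp => ⟨p, hp⟩) fun p hp => ?_, ?_⟩
  · have := Nat.prime_of_mem_primeFactorsList hp
    exact this.dvd_of_dvd_pow ((Nat.dvd_of_mem_primeFactorsList hp).trans hk)
  · rw [List.map_pmap]
    simpa using Nat.prod_primeFactorsList hm

theorem MulDefined.exists_rat {N : ℕ} {α : ℝ} (h : MulDefined N α) :
    ∃ β : ℚ, SmoothRat N β ∧ α = β := by
  obtain ⟨F, ps, qs, h, -⟩ := h
  exact ⟨_, ⟨_, _, smooth_list_prod ps, smooth_list_prod qs, rfl⟩, by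
    rw [h, Rat.cast_div, Rat.cast_natCast, Rat.cast_natCast]⟩

theorem SmoothRat.mulDefined {N : ℕ} [NeZero N] {β : ℚ} (h : SmoothRat N β) :
    MulDefined N (β : ℝ) := by
  obtain ⟨a, b, ha, hb, rfl⟩ := h
  obtain ⟨ps, rfl⟩ := exists_list_prod ha
  obtain ⟨qs, rfl⟩ := exists_list_prod hb
  exact ⟨_, ps, qs, by rw [Rat.cast_div, Rat.cast_natCast, Rat.cast_natCast], rfl⟩

theorem fl_Mul {N : ℕ} [NeZero N] {β : ℚ} (hβ : SmoothRat N β) (x : Config N) {α : ℚ} {M : ℕ}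
    (hα : SmoothRat N α) (hM : Smooth N M) : fl N (Mul N (β : ℝ) x) α M = fl N x (β * α) M := by
  have hdef := hβ.mulDefined
  have h1 : Mul N (β : ℝ) x = hdef.choose x := by rw [Mul, dif_pos hdef]
  obtain ⟨ps, qs, h2, h3⟩ := hdef.choose_spec
  have h2' : β = ((ps.map Subtype.val).prod : ℕ) / ((qs.map Subtype.val).prod : ℕ) := by
    rw [← Rat.cast_inj (α := ℝ), h2, Rat.cast_div, Rat.cast_natCast, Rat.cast_natCast]
  have hQ := smooth_list_prod qs
  -- Inverse automata have no formula yet, so both sides are expressed through the preimage `y`,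
  -- where only products of divisors occur.
  set y := (mulList N qs)⁻¹ x with hy
  have hx : x = mulList N qs y := by rw [hy, ← Equiv.Perm.mul_apply, mul_inv_cancel, Equiv.Perm.one_apply]
  rw [h1, h3, Equiv.Perm.mul_apply, ← hy, fl_mulList _ _ hα hM, hx,
    fl_mulList _ _ (hβ.mul hα) hM, h2']
  congr 1
  have := hQ.cast_ne_zero
  field_simp

theorem Mul_apply_eq_fl {N : ℕ} [NeZero N] {β : ℚ} (hβ : SmoothRat N β) (x : Config N) (i : ℤ) :
    (Mul N (β : ℝ) x i : ℕ) = fl N x (β * (N : ℚ) ^ i) N := by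
  rw [← fl_Mul hβ x ((Smooth.self N).rat.zpow i) (Smooth.self N), fl_zpow]

/-! ### Weights and tessellations -/

section Weights

variable {d : ℕ} (n : Fin d → ℕ)

theorem mNat_zero : mNat n 0 = 1 := by simp [mNat]

theorem mNat_neg_e (i : Fin d) : mNat n (-e i) = n i := by
  rw [mNat, Finset.prod_eq_single i]
  · simp [e]
  · intro j _ hj
    simp [e, Pi.single_eq_of_ne hj]
  · simp

theorem mNat_neg_one : mNat n (fun _ => -1) = ∏ i, n i := by simp [mNat]

theorem cube_edgeFace (a : ℕ) (i : Fin d) : cube n a (edgeFace i) = a % n i := by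
  show midDigit n a 0 (-e i) = _
  rw [midDigit, mNat_zero, mNat_neg_e, Nat.div_one, Nat.div_one]

theorem val_cube (a : ℕ) : val (cube n a) = a % ∏ i, n i := by
  show midDigit n a 0 (fun _ => -1) = _
  rw [midDigit, mNat_zero, mNat_neg_one, Nat.div_one, Nat.div_one]

variable {n} {N : ℕ}

theorem smoothRat_wgt (hn : ∀ i, Smooth N (n i)) (v : Fin d → ℤ) : SmoothRat N (wgt n v) :=
  SmoothRat.prod _ _ fun i _ => (hn i).rat.zpow _

variable [NeZero N]

theorem wgt_add (hn : ∀ i, Smooth N (n i)) (v w : Fin d → ℤ) :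
    wgt n (v + w) = wgt n v * wgt n w := by
  rw [wgt, wgt, wgt, ← Finset.prod_mul_distrib]
  refine Finset.prod_congr rfl fun i _ => ?_
  rw [Pi.add_apply, neg_add, zpow_add₀ (hn i).cast_ne_zero]

theorem wgt_neg (v : Fin d → ℤ) : wgt n (-v) = (wgt n v)⁻¹ := by
  rw [wgt, wgt, ← Finset.prod_inv_distrib]
  exact Finset.prod_congr rfl fun i _ => by rw [Pi.neg_apply, zpow_neg]

theorem wgt_e (i : Fin d) : wgt n (e i) = (n i : ℚ)⁻¹ := by
  rw [← inv_inj, ← wgt_neg, inv_inv, ← mNat_cast, mNat_neg_e]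
  intro j
  by_cases h : j = i
  · subst h; simp [e]
  · simp [e, Pi.single_eq_of_ne h]

theorem wgt_const (k : ℤ) : wgt n (fun _ => k) = ((∏ i, n i : ℕ) : ℚ) ^ (-k) := by
  rw [wgt, Finset.prod_zpow, Nat.cast_prod]

theorem shiftFactor_eq (z : Fin d → ℤ) : shiftFactor z n = (((wgt n z)⁻¹ : ℚ) : ℝ) := by
  rw [← wgt_neg, shiftFactor, wgt]
  push_cast
  simp

theorem tess_edgeFace (hn : ∏ i, n i = N) (x : Config N) (z : Fin d → ℤ) (i : Fin d) :
    tess N n x z (edgeFace i) = fl N x (wgt n z)⁻¹ (n i) := by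
  have hd (i) : n i ∣ N := hn ▸ Finset.dvd_prod_of_mem n (Finset.mem_univ i)
  have hw := (smoothRat_wgt (fun i => .of_dvd (hd i)) z).inv
  rw [tess, cube_edgeFace, shiftFactor_eq, Mul_apply_eq_fl hw, zpow_zero, mul_one,
    (isFamily_fl x).mod hw (Smooth.self N) (hd i)]

/-! ### Path integrals -/

theorem e_injective : Function.Injective (e : Fin d → Fin d → ℤ) := fun i j h => by
  by_contra hij
  have := congrFun h i
  simp [e, Pi.single_eq_of_ne hij] at this

/-- Coordinate i rises by 1 or 2. Hence no step is both forward and backward, and only one summand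
of `edgeInt` survives. -/
theorem add_e_add_e_ne (p : Fin d → ℤ) (i j : Fin d) : p ≠ p + e i + e j := fun h => by
  have := congrFun h i
  by_cases hij : i = j
  · subst hij; simp [e] at this; omega
  · simp [e, Pi.single_eq_of_ne hij] at this

theorem edgeInt_add_e (f : Tiling d) (p : Fin d → ℤ) (i : Fin d) :
    edgeInt n f p (p + e i) = wgt n (p + e i) * f (p + e i) (edgeFace i) := by
  rw [edgeInt, Finset.sum_eq_single i]
  · simp
  · intro j _ hj
    rw [if_neg fun h => hj (e_injective (add_left_cancel h)).symm, if_neg (add_e_add_e_ne p i j)]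
  · simp

theorem edgeInt_sub_e (f : Tiling d) (p : Fin d → ℤ) (i : Fin d) :
    edgeInt n f (p + e i) p = -(wgt n (p + e i) * f (p + e i) (edgeFace i)) := by
  rw [edgeInt, Finset.sum_eq_single i]
  · rw [if_neg (add_e_add_e_ne p i i), if_pos rfl]
  · intro j _ hj
    rw [if_neg (add_e_add_e_ne p i j), if_neg fun h => hj (e_injective (add_left_cancel h)).symm]
  · simp

/-- The potential of a tessellation that belongs to the real number `t`. -/
def potential (n : Fin d → ℕ) (t : ℚ) (p : Fin d → ℤ) : ℚ := ⌊(wgt n p)⁻¹ * t⌋₊ * wgt n p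

/-- The potential is t rounded down to a multiple of the weight. A step along `e i` refines the
weight by the factor `n i`, and the rounding gains one digit in base `n i`, which is the edge label.
-/
theorem potential_add_e (hn : ∀ i, Smooth N (n i)) (t : ℚ) (p : Fin d → ℤ) (i : Fin d) :
    potential n t (p + e i) - potential n t p =
      wgt n (p + e i) * ((⌊(wgt n (p + e i))⁻¹ * t⌋₊ % n i : ℕ) : ℚ) := by
  have hp : wgt n p = n i * wgt n (p + e i) := by
    rw [wgt_add hn, wgt_e, mul_left_comm, mul_inv_cancel₀ (hn i).cast_ne_zero, mul_one]
  have h1 : ⌊(wgt n p)⁻¹ * t⌋₊ = ⌊(wgt n (p + e i))⁻¹ * t⌋₊ / n i := by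
    rw [← Nat.floor_div_natCast, hp, mul_inv]
    congr 1
    rw [div_eq_mul_inv]
    ring
  have h2 : (⌊(wgt n (p + e i))⁻¹ * t⌋₊ : ℚ) =
      n i * ((⌊(wgt n (p + e i))⁻¹ * t⌋₊ / n i : ℕ) : ℚ) +
        ((⌊(wgt n (p + e i))⁻¹ * t⌋₊ % n i : ℕ) : ℚ) := by
    exact_mod_cast (Nat.div_add_mod _ _).symm
  rw [potential, potential, h1, hp, h2]
  ring

/-- Edge labels are potential differences and telescope. As ξ may be infinite, the potential is
taken for truncations; a path has finitely many edges, so one large K serves them all. -/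
theorem eventually_pathInt (hn : ∀ i, Smooth N (n i)) (x : Config N) (f : Tiling d)
    (hf : ∀ z i, f z (edgeFace i) = fl N x (wgt n z)⁻¹ (n i)) (P : List (Fin d → ℤ))
    (p p' : Fin d → ℤ) (hP : IsPath P p p') : ∀ᶠ K in atTop,
      pathInt n f P = potential n (trunc N x K) p' - potential n (trunc N x K) p := by
  have hedge (p p' : Fin d → ℤ) (h : Adj p p') : ∀ᶠ K in atTop,
      edgeInt n f p p' = potential n (trunc N x K) p' - potential n (trunc N x K) p := by
    obtain ⟨i, rfl | rfl⟩ := h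
    · filter_upwards [eventually_fl x (smoothRat_wgt hn (p + e i)).inv (hn i)] with K hK
      rw [edgeInt_add_e, potential_add_e hn, hf, hK]
    · filter_upwards [eventually_fl x (smoothRat_wgt hn (p' + e i)).inv (hn i)] with K hK
      rw [edgeInt_sub_e, ← neg_sub, potential_add_e hn, hf, hK]
  obtain ⟨h1, h2, h3⟩ := hP
  induction P generalizing p with
  | nil => simp at h1
  | cons a P ih =>
    obtain rfl : a = p := by simpa using h1
    cases P with
    | nil =>
      obtain rfl : a = p' := by simpa using h2
      simp [pathInt]
    | cons b P =>
      rw [List.isChain_cons_cons] at h3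
      filter_upwards [hedge a b h3.1, ih b rfl (by simpa using h2) h3.2] with K hK1 hK2
      rw [pathInt, hK1, hK2]
      ring

/-- Divided by the weight of p', the potential difference is ⌊s⌋ - c ⌊s / c⌋ = ⌊s⌋ mod c, where s is
the truncated number divided by that weight. In particular the choice of path is immaterial. -/
theorem lbl_eq_fl (hn : ∀ i, Smooth N (n i)) (x : Config N) (f : Tiling d)
    (hf : ∀ z i, f z (edgeFace i) = fl N x (wgt n z)⁻¹ (n i)) (p p' : Fin d → ℤ) (c : ℕ)
    (hc : wgt n p = c * wgt n p') (hcs : Smooth N c) :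
    lbl n f p p' = fl N x (wgt n p')⁻¹ c := by
  have hw := smoothRat_wgt hn p'
  obtain ⟨K, h1, h2⟩ := ((eventually_pathInt hn x f hf _ p p' (exists_isPath p p').choose_spec).and
    (eventually_fl x hw.inv hcs)).exists
  rw [lbl, integral, h1, ← h2, div_eq_iff hw.pos.ne', potential, potential]
  have h3 : ⌊(wgt n p)⁻¹ * trunc N x K⌋₊ = ⌊(wgt n p')⁻¹ * trunc N x K⌋₊ / c := by
    rw [← Nat.floor_div_natCast, hc, mul_inv]
    congr 1
    rw [div_eq_mul_inv]
    ring
  have h4 : (⌊(wgt n p')⁻¹ * trunc N x K⌋₊ : ℚ) =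
      c * ((⌊(wgt n p')⁻¹ * trunc N x K⌋₊ / c : ℕ) : ℚ) +
        ((⌊(wgt n p')⁻¹ * trunc N x K⌋₊ % c : ℕ) : ℚ) := by
    exact_mod_cast (Nat.div_add_mod _ _).symm
  rw [h3, hc, h4]
  ring

end Weights

/-! ### Macrotiles and microtiles of the tessellations of a configuration -/

section Tiles

variable {d d' : ℕ} {n : Fin d → ℕ} {N : ℕ}

theorem mNat_smooth (hn : ∀ i, Smooth N (n i)) (v : Fin d → ℤ) : Smooth N (mNat n v) :=
  Smooth.prod _ _ fun i _ => (hn i).pow _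

theorem mNat_dvd {v w : Fin d → ℤ} (h : w ≤ v) : mNat n v ∣ mNat n w :=
  Finset.prod_dvd_prod_of_dvd _ _ fun j _ =>
    pow_dvd_pow _ (Int.toNat_le_toNat (neg_le_neg (h j)))

theorem prePow_smooth (hn : ∀ i, Smooth N (n i)) (A : Matrix (Fin d) (Fin d') ℕ) (i : Fin d') :
    Smooth N (prePow n A i) :=
  Smooth.prod _ _ fun j _ => (hn j).pow _

variable [NeZero N]

theorem wgt_prePow (hn : ∀ i, Smooth N (n i)) (A : Matrix (Fin d) (Fin d') ℕ) (v : Fin d' → ℤ) :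
    wgt (prePow n A) v = wgt n (act A v) := by
  have h (j : Fin d) : (n j : ℚ) ^ (-act A v j) = ∏ i, ((n j : ℚ) ^ A j i) ^ (-v i) := by
    have hsum : -act A v j = ∑ i, (A j i : ℤ) * -v i := by
      simp [act, Matrix.mulVec, dotProduct]
    have hpow (s : Finset (Fin d')) (g : Fin d' → ℤ) :
        (n j : ℚ) ^ (∑ i ∈ s, g i) = ∏ i ∈ s, (n j : ℚ) ^ g i := by
      classical
      induction s using Finset.induction_on with
      | empty => simp
      | insert a s ha ih =>
        rw [Finset.sum_insert ha, Finset.prod_insert ha, zpow_add₀ (hn j).cast_ne_zero, ih]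
    rw [hsum, hpow]
    exact Finset.prod_congr rfl fun i _ => by rw [zpow_mul, zpow_natCast]
  simp only [wgt, h]
  rw [Finset.prod_comm]
  refine Finset.prod_congr rfl fun i _ => ?_
  rw [Finset.prod_zpow, prePow]
  push_cast
  rfl

theorem macroMap_tess (hn : ∏ i, n i = N) (A : Matrix (Fin d) (Fin d') ℕ) (x : Config N)
    (v : Fin d' → ℤ) : macroMap A n (tess N n x) v =
      cube (prePow n A) (fl N x (wgt (prePow n A) v)⁻¹ (∏ i, prePow n A i)) := by
  have hs (i) : Smooth N (n i) := .of_dvd (hn ▸ Finset.dvd_prod_of_mem n (Finset.mem_univ i))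
  have hs' := prePow_smooth hs A
  have hone : wgt (prePow n A) (-1) = (∏ i, prePow n A i : ℕ) := by
    rw [show (-1 : Fin d' → ℤ) = fun _ => -1 from rfl, wgt_const, neg_neg, zpow_one]
  rw [macroMap, lbl_eq_fl hs x _ (tess_edgeFace hn x) _ _ (∏ i, prePow n A i) _
    (Smooth.prod _ _ fun i _ => hs' i), Nat.floor_natCast, wgt_prePow hs]
  rw [← wgt_prePow hs, ← wgt_prePow hs, sub_eq_add_neg, wgt_add hs', hone, mul_comm]

theorem microMap_tess (A : Matrix (Fin d) (Fin d') ℕ) (hs : ∀ i, Smooth N (n i))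
    (hn : ∏ i, prePow n A i = N) (x : Config N) (p : Fin d → ℤ)
    (h : ∃ z : (Fin d' → ℤ) × (Fin d' → ℤ), p ≤ act A z.1 ∧ z.2 ≤ z.1 ∧ act A z.2 ≤ p - 1) :
    microMap A n (tess N (prePow n A) x) p = cube n (fl N x (wgt n p)⁻¹ (∏ i, n i)) := by
  have hs' := prePow_smooth hs A
  rw [microMap, dif_pos h]
  obtain ⟨h1, h2, h3⟩ := h.choose_spec
  set z₁ := h.choose.1
  set z₂ := h.choose.2
  have hc : wgt (prePow n A) z₂ = mNat (prePow n A) (z₂ - z₁) * wgt (prePow n A) z₁ := by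
    rw [mNat_cast, ← wgt_add hs', sub_add_cancel]
    exact sub_nonpos.2 h2
  have hcn : mNat (prePow n A) (z₂ - z₁) = mNat n (act A z₂ - act A z₁) := by
    have hle : act A z₂ ≤ act A z₁ := h3.trans ((sub_le_self p zero_le_one).trans h1)
    have := mNat_cast (prePow n A) _ (sub_nonpos.2 h2)
    rw [wgt_prePow hs] at this
    have h4 : act A (z₂ - z₁) = act A z₂ - act A z₁ := Matrix.mulVec_sub _ _ _
    rw [h4, ← mNat_cast _ _ (sub_nonpos.2 hle)] at this
    exact_mod_cast this
  have hw := smoothRat_wgt hs' z₁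
  rw [lbl_eq_fl hs' x _ (tess_edgeFace hn x) _ _ _ hc (mNat_smooth hs' _), Nat.floor_natCast, hcn]
  -- Here `v` is nonpositive: it is the negative of the vector called v in the definition of
  -- microtiles.
  set v := -(act A z₁ - p) with hv
  have hv0 : v ≤ 0 := neg_nonpos.2 (sub_nonneg.2 h1)
  have hv1 : v - 1 ≤ 0 := (sub_le_self v zero_le_one).trans hv0
  have hprod : mNat n (v - 1) = mNat n v * ∏ i, n i := by
    have : (mNat n (v - 1) : ℚ) = (mNat n v * ∏ i, n i : ℕ) := by
      rw [mNat_cast _ _ hv1, Nat.cast_mul, mNat_cast _ _ hv0, sub_eq_add_neg, wgt_add hs,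
        show (-1 : Fin d → ℤ) = fun _ => -1 from rfl, wgt_const, neg_neg, zpow_one]
    exact_mod_cast this
  have hvs := mNat_smooth hs v
  have hps : Smooth N (∏ i, n i) := Smooth.prod _ _ fun i _ => hs i
  -- Since A z₂ ≤ p - 1, the label retains enough digits: its modulus is a multiple of everything
  -- the middle digit looks at.
  have hdvd : mNat n v * ∏ i, n i ∣ mNat n (act A z₂ - act A z₁) := by
    rw [← hprod]
    refine mNat_dvd ?_
    rw [hv]
    intro j
    have := h3 j
    simp only [Pi.sub_apply, Pi.neg_apply, Pi.one_apply] at this ⊢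
    omega
  rw [midDigit, hprod, Nat.mul_div_cancel_left _ hvs.pos, ← Nat.mod_mul_right_div_self,
    (isFamily_fl x).mod hw.inv (mNat_smooth hs _) hdvd, ← (isFamily_fl x).div hw.inv hvs hps]
  congr 2
  have hp : wgt n p = wgt (prePow n A) z₁ * mNat n v := by
    rw [mNat_cast _ _ hv0, wgt_prePow hs, ← wgt_add hs]
    congr 1
    rw [hv]
    abel
  rw [hp, mul_inv, div_eq_mul_inv]

end Tiles

/-! ### Prime factors -/

theorem primeVec_mem (N : ℕ) (i) : primeVec N i ∈ N.primeFactors :=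
  Finset.orderEmbOfFin_mem _ rfl i

theorem primeVec_prime (N : ℕ) (i) : (primeVec N i).Prime :=
  Nat.prime_of_mem_primeFactors (primeVec_mem N i)

theorem prod_primeVec_apply (N : ℕ) (g : ℕ → ℕ) :
    ∏ i, g (primeVec N i) = ∏ p ∈ N.primeFactors, g p := by
  refine (Finset.prod_map _ (N.primeFactors.orderEmbOfFin rfl).toEmbedding g).symm.trans ?_
  rw [Finset.map_orderEmbOfFin_univ]

theorem prod_primeVec (N : ℕ) : ∏ i, primeVec N i = rad N := prod_primeVec_apply N id

theorem prod_primePowVec (N : ℕ) [NeZero N] : ∏ i, primePowVec N i = N := by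
  refine (prod_primeVec_apply N fun p => p ^ N.factorization p).trans ?_
  exact Nat.prod_factorization_pow_eq_self (NeZero.ne N)

theorem primeFactors_rad (N : ℕ) : (rad N).primeFactors = N.primeFactors :=
  Nat.primeFactors_prod fun _ => Nat.prime_of_mem_primeFactors

theorem rad_rad (N : ℕ) : rad (rad N) = rad N := by rw [rad, primeFactors_rad, rad]

theorem smooth_of_prime_dvd {N m : ℕ} [NeZero m] (h : ∀ p : ℕ, p.Prime → p ∣ m → p ∣ N) :
    Smooth N m := by
  rw [← prod_primePowVec m]
  exact Smooth.prod _ _ fun i _ => (Smooth.of_dvd (h _ (primeVec_prime m i)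
    (Nat.dvd_of_mem_primeFactors (primeVec_mem m i)))).pow _

theorem prime_dvd_rad {N p : ℕ} [NeZero N] (hp : p.Prime) : p ∣ rad N ↔ p ∣ N := by
  have h1 := Nat.mem_primeFactors_of_ne_zero (p := p) (NeZero.ne N)
  have h2 := Nat.mem_primeFactors_of_ne_zero (p := p) (NeZero.ne (rad N))
  rw [primeFactors_rad] at h2
  tauto

theorem smooth_rad (N : ℕ) [NeZero N] : Smooth N (rad N) :=
  smooth_of_prime_dvd fun _ hp => (prime_dvd_rad hp).1

theorem smooth_rad_self (N : ℕ) [NeZero N] : Smooth (rad N) N :=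
  smooth_of_prime_dvd fun _ hp => (prime_dvd_rad hp).2

theorem prePow_expMatrix (N : ℕ) : prePow (primeVec N) (expMatrix N) = primePowVec N := by
  funext i
  rw [prePow, Finset.prod_eq_single i]
  · simp [expMatrix, primePowVec]
  · intro j _ hj
    simp [expMatrix, Matrix.diagonal_apply_ne _ hj]
  · simp

theorem prePow_selMatrix {M M' : ℕ} (h : M'.primeFactors ⊆ M.primeFactors) :
    prePow (primeVec M) (selMatrix M M') = primeVec M' := by
  funext i
  have h1 (k) : primeVec M k ^ selMatrix M M' k i =
      (fun q => if q = primeVec M' i then q else 1) (primeVec M k) := by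
    by_cases hk : primeVec M k = primeVec M' i <;> simp [selMatrix, hk]
  rw [prePow, Finset.prod_congr rfl fun k _ => h1 k]
  refine (prod_primeVec_apply M fun q => if q = primeVec M' i then q else 1).trans ?_
  rw [Finset.prod_ite_eq', if_pos (h (primeVec_mem M' i))]

/-! ### The conjugacies and the factor maps -/

theorem conjRad_apply (N M : ℕ) [NeZero N] [NeZero M] (hM : M = rad N) (x : Config N) (i : ℤ) :
    (conjRad N M x i : ℕ) = fl N x ((M : ℚ) ^ i) M := by
  have hs (i) : Smooth N (primeVec N i) :=
    .of_dvd (Nat.dvd_of_mem_primeFactors (primeVec_mem N i))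
  have hprod := (prod_primeVec N).trans hM.symm
  have hMs : Smooth N M := hM ▸ smooth_rad N
  have hz : ∃ z : (Fin N.primeFactors.card → ℤ) × (Fin N.primeFactors.card → ℤ),
      (fun _ => i) ≤ act (expMatrix N) z.1 ∧ z.2 ≤ z.1 ∧
        act (expMatrix N) z.2 ≤ (fun _ => i) - 1 := by
    have hact (c : ℤ) (j) : act (expMatrix N) (fun _ => c) j =
        N.factorization (primeVec N j) * c := by
      simp [act, expMatrix, Matrix.mulVec, dotProduct, Matrix.diagonal_apply]
    have hpos (j) : 1 ≤ (N.factorization (primeVec N j) : ℤ) := by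
      have := (Nat.prime_of_mem_primeFactors (primeVec_mem N j)).factorization_pos_of_dvd
        (NeZero.ne N) (Nat.dvd_of_mem_primeFactors (primeVec_mem N j))
      exact_mod_cast this
    -- All exponents are at least 1, so multiplying by them only moves |i| up and -|i| - 1 down.
    refine ⟨⟨fun _ => |i|, fun _ => -|i| - 1⟩, fun j => ?_, fun j => ?_, fun j => ?_⟩
    · rw [hact]
      nlinarith [hpos j, le_abs_self i, abs_nonneg i]
    · have := abs_nonneg i
      simp only
      omega
    · rw [hact]
      simp only [Pi.sub_apply, Pi.one_apply]
      nlinarith [hpos j, neg_abs_le i, abs_nonneg i]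
  have hmicro := microMap_tess (expMatrix N) hs
    (by rw [prePow_expMatrix, prod_primePowVec]) x _ hz
  rw [prePow_expMatrix, wgt_const, ← zpow_neg, neg_neg, hprod] at hmicro
  rw [conjRad, diag, hmicro, val_cube, hprod, Fin.val_ofNat, Nat.mod_mod,
    (isFamily_fl x).mod (hMs.rat.zpow i) hMs dvd_rfl]

theorem fl_conjRad {N M : ℕ} [NeZero N] [NeZero M] (hM : M = rad N) (x : Config N) {α : ℚ} {m : ℕ}
    (hα : SmoothRat M α) (hm : Smooth M m) : fl M (conjRad N M x) α m = fl N x α m :=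
  fl_eq_of_digits ((isFamily_fl x).restrict (hM ▸ smooth_rad N)) _ (conjRad_apply N M hM x) hα hm

theorem conjRad_injective {N M : ℕ} [NeZero N] [NeZero M] (hM : M = rad N) :
    Function.Injective (conjRad N M) := fun x y h => by
  have hN : Smooth M N := hM ▸ smooth_rad_self N
  refine funext fun i => Fin.ext ?_
  rw [← fl_zpow, ← fl_zpow, ← fl_conjRad hM x (hN.rat.zpow i) hN,
    ← fl_conjRad hM y (hN.rat.zpow i) hN, h]

theorem conjMap_apply {N N' : ℕ} [NeZero N] [NeZero N'] (h : rad N = rad N') (x : Config N)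
    (i : ℤ) : (conjMap N N' x i : ℕ) = fl N x ((N' : ℚ) ^ i) N' := by
  -- The candidate `y` is the same number written in base N'. It has the same image in base `rad N`,
  -- so injectivity evaluates the `invFun`.
  have hs : Smooth N N' := (h ▸ smooth_rad_self N' : Smooth (rad N) N').trans (smooth_rad N)
  have hr : Smooth N' (rad N) := h ▸ smooth_rad N'
  obtain ⟨y, hy⟩ := exists_config ((isFamily_fl x).restrict hs)
  have hxy : conjRad N (rad N) x = conjRad N' (rad N) y := by
    refine funext fun i => Fin.ext ?_
    rw [conjRad_apply _ _ rfl, conjRad_apply _ _ h,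
      fl_eq_of_digits ((isFamily_fl x).restrict hs) y hy (hr.rat.zpow i) hr]
  rw [conjMap, hxy, Function.leftInverse_invFun (conjRad_injective h), hy]

theorem factSqfree_apply {M M' : ℕ} [NeZero M] [NeZero M'] (hM : rad M = M) (hM' : rad M' = M')
    (h : M'.primeFactors ⊆ M.primeFactors) (x : Config M) (i : ℤ) :
    (factSqfree M M' x i : ℕ) = fl M x ((M' : ℚ) ^ i) M' := by
  have hs : Smooth M M' := smooth_of_prime_dvd fun p hp hd => Nat.dvd_of_mem_primeFactors
    (h (hp.mem_primeFactors hd (NeZero.ne M')))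
  have hprod := (prod_primeVec M').trans hM'
  have hcubes := macroMap_tess ((prod_primeVec M).trans hM) (selMatrix M M') x fun _ => i
  rw [prePow_selMatrix h, wgt_const, ← zpow_neg, neg_neg, hprod] at hcubes
  rw [factSqfree, diag, hcubes, val_cube, hprod, Fin.val_ofNat, Nat.mod_mod,
    (isFamily_fl x).mod (hs.rat.zpow i) hs dvd_rfl]

theorem factMap_apply {N N' : ℕ} [NeZero N] [NeZero N'] (h : Smooth N N') (x : Config N) (i : ℤ) :
    (factMap N N' x i : ℕ) = fl N x ((N' : ℚ) ^ i) N' := by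
  obtain ⟨k, hk⟩ := h
  have hsub : (rad N').primeFactors ⊆ (rad N).primeFactors := fun p hp => by
    rw [primeFactors_rad] at hp ⊢
    have hpp := Nat.prime_of_mem_primeFactors hp
    exact hpp.mem_primeFactors
      (hpp.dvd_of_dvd_pow ((Nat.dvd_of_mem_primeFactors hp).trans hk)) (NeZero.ne N)
  have hs : Smooth (rad N) (rad N') := smooth_of_prime_dvd fun p hp hd => Nat.dvd_of_mem_primeFactors
    (hsub (hp.mem_primeFactors hd (NeZero.ne (rad N'))))
  set u := conjMap N (rad N) x with hu
  set w := factSqfree (rad N) (rad N') u with hw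
  have h1 : (factMap N N' x i : ℕ) = fl (rad N') w ((N' : ℚ) ^ i) N' :=
    conjMap_apply (rad_rad N') w i
  have hN' := smooth_rad_self N'
  rw [h1, fl_eq_of_digits ((isFamily_fl u).restrict hs) w
      (factSqfree_apply (rad_rad N) (rad_rad N') hsub u) (hN'.rat.zpow i) hN',
    fl_eq_of_digits ((isFamily_fl x).restrict (smooth_rad N)) u
      (conjMap_apply (rad_rad N).symm x) ((hN'.trans hs).rat.zpow i) (hN'.trans hs)]

theorem fl_factMap {N N' : ℕ} [NeZero N] [NeZero N'] (h : Smooth N N') (x : Config N) {α : ℚ}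
    {M : ℕ} (hα : SmoothRat N' α) (hM : Smooth N' M) :
    fl N' (factMap N N' x) α M = fl N x α M :=
  fl_eq_of_digits ((isFamily_fl x).restrict h) _ (factMap_apply h x) hα hM

/-! ### Equivariance, continuity and surjectivity -/

theorem continuous_Mul {N : ℕ} [NeZero N] {β : ℚ} (hβ : SmoothRat N β) :
    Continuous (Mul N (β : ℝ)) :=
  continuous_of_digits _ (fun _ => N) (fun i => β * (N : ℚ) ^ i)
    (fun i => hβ.mul ((Smooth.self N).rat.zpow i)) (fun _ => .self N) (Mul_apply_eq_fl hβ)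

theorem continuous_factMap {N N' : ℕ} [NeZero N] [NeZero N'] (h : Smooth N N') :
    Continuous (factMap N N') :=
  continuous_of_digits _ (fun _ => N') (fun i => (N' : ℚ) ^ i) (fun i => h.rat.zpow i)
    (fun _ => h) (factMap_apply h)

theorem factMap_Mul {N N' : ℕ} [NeZero N] [NeZero N'] (h : Smooth N N') {β : ℚ}
    (hβ : SmoothRat N' β) (x : Config N) :
    factMap N N' (Mul N (β : ℝ) x) = Mul N' (β : ℝ) (factMap N N' x) := by
  have hN' := Smooth.self N'
  refine funext fun i => Fin.ext ?_
  rw [factMap_apply h, fl_Mul (hβ.trans h) x (h.rat.zpow i) h, Mul_apply_eq_fl hβ,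
    fl_factMap h x (hβ.mul (hN'.rat.zpow i)) hN']

theorem factMap_surjective {N N' : ℕ} [NeZero N] [NeZero N'] (h : Smooth N N') :
    Function.Surjective (factMap N N') := by
  intro y
  have hclosed : IsClosed (Set.range (factMap N N')) :=
    (isCompact_range (continuous_factMap h)).isClosed
  -- The K-th truncation of `y` is a finite rational number, and `x K` is its base N expansion. Its
  -- image agrees with `y` on [-K, K].
  choose x hx using fun K => exists_config (isFamily_floor N (trunc N' y K))
  suffices hlim : Tendsto (fun K => factMap N N' (x K)) atTop (𝓝 y) from
    hclosed.mem_of_tendsto hlim (Eventually.of_forall fun K => ⟨_, rfl⟩)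
  refine tendsto_pi_nhds.2 fun i => tendsto_nhds_of_eventually_eq ?_
  filter_upwards [eventually_ge_atTop i.natAbs] with K hK
  refine Fin.ext ?_
  rw [factMap_apply h, fl_eq_of_digits (isFamily_floor N (trunc N' y K)) _ (hx K) (h.rat.zpow i) h,
    floor_trunc y hK]

theorem isFactorMap_factMap {N N' : ℕ} [NeZero N] [NeZero N'] (h : Smooth N N') {β : ℚ}
    (hβ : SmoothRat N' β) : IsFactorMap (Mul N (β : ℝ)) (Mul N' (β : ℝ)) (factMap N N') where
  compact_source := inferInstance
  metrizable_source := inferInstance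
  compact_target := inferInstance
  metrizable_target := inferInstance
  continuous_source := continuous_Mul (hβ.trans h)
  continuous_target := continuous_Mul hβ
  continuous_map := continuous_factMap h
  equivariant := funext (factMap_Mul h hβ)
  surjective := factMap_surjective h

/-! ### The represented numbers -/

theorem window_eq_sum (N : ℕ) (x : Config N) (j : ℤ) (m : ℕ) :
    window N x j m = ∑ t ∈ Finset.range (m + 1), (x (j + t) : ℕ) * N ^ (m - t) := by
  induction m with
  | zero => simp [window]
  | succ m ih =>
    rw [Finset.sum_range_succ, window, ih, Finset.mul_sum, Nat.sub_self, pow_zero, mul_one]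
    refine congrArg (· + _) (Finset.sum_congr rfl fun t ht => ?_)
    rw [Nat.succ_sub (Nat.lt_succ_iff.1 (Finset.mem_range.1 ht)), pow_succ]
    ring

theorem trunc_eq_sum (N : ℕ) [NeZero N] (x : Config N) (K : ℕ) :
    trunc N x K = ∑ i ∈ Finset.Icc (-K : ℤ) K, (x (-i) : ℕ) * (N : ℚ) ^ i := by
  rw [trunc, window_eq_sum, Nat.cast_sum, Finset.sum_div]
  -- The digit in place t of the window stands at position t - K and has weight N^(K - t).
  refine Finset.sum_nbij' (fun t => (K : ℤ) - t) (fun i => (K - i).toNat) ?_ ?_ ?_ ?_ ?_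
  · intro t ht
    simp only [Finset.mem_range, Finset.mem_Icc] at ht ⊢
    omega
  · intro t ht
    simp only [Finset.mem_range, Finset.mem_Icc] at ht ⊢
    omega
  · intro t ht
    omega
  · intro t ht
    simp only [Finset.mem_Icc] at ht
    omega
  · intro t ht
    have hN : (N : ℚ) ≠ 0 := (Smooth.self N).cast_ne_zero
    have ht' : t ≤ 2 * K := Nat.lt_succ_iff.1 (Finset.mem_range.1 ht)
    rw [neg_sub, sub_eq_add_neg (t : ℤ), add_comm (t : ℤ), Nat.cast_mul, Nat.cast_pow,
      mul_div_assoc, ← zpow_natCast, ← zpow_natCast, ← zpow_sub₀ hN]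
    congr 2
    push_cast [ht']
    ring

theorem exists_nnreal_trunc {N : ℕ} [NeZero N] (x : Config N) : ∃ s : ℕ → NNReal,
    (∀ K, (s K : ℝ) = trunc N x K) ∧ (∀ K, (s K : ℝ≥0∞) ≤ realOf N x) ∧
      Tendsto (fun K => (s K : ℝ≥0∞)) atTop (𝓝 (realOf N x)) := by
  let s (K : ℕ) : NNReal := ∑ i ∈ Finset.Icc (-K : ℤ) K, ((x (-i) : ℕ) : NNReal) * (N : NNReal) ^ i
  have hs (K : ℕ) : (s K : ℝ≥0∞) =
      ∑ i ∈ Finset.Icc (-K : ℤ) K, ((x (-i) : ℕ) : ℝ≥0∞) * (N : ℝ≥0∞) ^ i := by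
    have hN : (N : NNReal) ≠ 0 := Nat.cast_ne_zero.2 (NeZero.ne N)
    simp only [s]
    push_cast
    refine Finset.sum_congr rfl fun i _ => ?_
    rw [ENNReal.coe_zpow hN, ENNReal.coe_natCast]
  refine ⟨s, fun K => ?_, fun K => ?_, ?_⟩
  · rw [trunc_eq_sum]
    simp only [s]
    push_cast
    rfl
  · rw [hs]
    exact ENNReal.sum_le_tsum _
  · simp only [hs]
    have h1 := (ENNReal.summable (f := fun i : ℤ =>
      ((x (-i) : ℕ) : ℝ≥0∞) * (N : ℝ≥0∞) ^ i)).hasSum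
    exact h1.comp (Finset.tendsto_Icc_neg.comp tendsto_natCast_atTop_atTop)

theorem window_eq_fl {N : ℕ} [NeZero N] (x : Config N) (j : ℤ) (m : ℕ) :
    window N x j m = fl N x ((N : ℚ) ^ (j + m)) (N ^ (m + 1)) := by
  induction m with
  | zero => simp [window, fl_zpow]
  | succ m ih =>
    rw [(isFamily_fl x).zpow_succ, fl_zpow, window, ih]
    push_cast
    rw [← add_assoc, add_sub_cancel_right]

theorem realOf_factMap {N N' : ℕ} [NeZero N] [NeZero N'] (h : Smooth N N') (hN' : 1 < N')
    (x : Config N) (hx : realOf N x ≠ ⊤) : realOf N' (factMap N N' x) = realOf N x := by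
  obtain ⟨s, hs, hs_le, hs_lim⟩ := exists_nnreal_trunc x
  obtain ⟨s', hs', -, hs'_lim⟩ := exists_nnreal_trunc (factMap N N' x)
  lift realOf N x to NNReal using hx with ξ
  have hle (L : ℕ) : (trunc N x L : ℝ) ≤ ξ := by
    rw [← hs]; exact_mod_cast hs_le L
  have hlim : Tendsto (fun L => (trunc N x L : ℝ)) atTop (𝓝 (ξ : ℝ)) := by
    simp only [← hs]
    exact NNReal.tendsto_coe.2 (ENNReal.tendsto_coe.1 hs_lim)
  have hpos (K : ℕ) : (0 : ℝ) < (N' : ℝ) ^ K := by positivity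
  -- For fixed K, the image digits at -K, …, K form one residue modulo N'^(2K+1), which a
  -- sufficiently long truncation of `x` computes.
  have hev (K : ℕ) : ∀ᶠ L in atTop,
      (s' K : ℝ) * (N' : ℝ) ^ K = ((⌊(N' : ℚ) ^ K * trunc N x L⌋₊ % N' ^ (2 * K + 1) : ℕ) : ℝ) := by
    have hK := h.rat.zpow (K : ℤ)
    filter_upwards [eventually_fl x hK (h.pow (2 * K + 1))] with L hL
    have h1 := fl_factMap h x ((Smooth.self N').rat.zpow (K : ℤ)) ((Smooth.self N').pow (2 * K + 1))
    have h2 := window_eq_fl (factMap N N' x) (-K) (2 * K)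
    rw [show (-K + (2 * K : ℕ) : ℤ) = K by push_cast; ring, h1, ← hL, zpow_natCast] at h2
    rw [hs', trunc, h2]
    push_cast
    exact div_mul_cancel₀ _ (hpos K).ne'
  have hup (K : ℕ) : (s' K : ℝ) ≤ ξ := by
    obtain ⟨L, hL⟩ := (hev K).exists
    have h1 : ((⌊(N' : ℚ) ^ K * trunc N x L⌋₊ % N' ^ (2 * K + 1) : ℕ) : ℚ) ≤
        (N' : ℚ) ^ K * trunc N x L :=
      (Nat.cast_le.2 (Nat.mod_le _ _)).trans
        (Nat.floor_le (mul_nonneg (by positivity) (trunc_nonneg N x L)))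
    have h2 : ((⌊(N' : ℚ) ^ K * trunc N x L⌋₊ % N' ^ (2 * K + 1) : ℕ) : ℝ) ≤
        (N' : ℝ) ^ K * trunc N x L := by exact_mod_cast h1
    rw [← hL, mul_comm] at h2
    exact (le_of_mul_le_mul_left h2 (hpos K)).trans (hle L)
  -- Once N'^K exceeds ξ, the integer part lies below the modulus, so reduction loses nothing and
  -- rounding costs less than N'^(-K).
  have hdown : ∀ᶠ K in atTop, (ξ : ℝ) - ((N' : ℝ)⁻¹) ^ K ≤ s' K := by
    have hbig : ∀ᶠ K in atTop, (ξ : ℝ) < (N' : ℝ) ^ K :=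
      (tendsto_pow_atTop_atTop_of_one_lt (Nat.one_lt_cast.2 hN')).eventually_gt_atTop _
    filter_upwards [hbig] with K hK
    refine le_of_tendsto (hlim.sub_const _) ((hev K).mono fun L hL => ?_)
    have h1 : ⌊(N' : ℚ) ^ K * trunc N x L⌋₊ < N' ^ (2 * K + 1) := by
      rw [Nat.floor_lt (mul_nonneg (by positivity) (trunc_nonneg N x L))]
      have h2 : (N' : ℝ) ^ K * trunc N x L < (N' : ℝ) ^ K * (N' : ℝ) ^ (K + 1) :=
        mul_lt_mul_of_pos_left ((hle L).trans_lt (hK.trans_le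
          (pow_le_pow_right₀ (Nat.one_le_cast.2 hN'.le) K.le_succ))) (hpos K)
      rw [← pow_add, show K + (K + 1) = 2 * K + 1 by ring] at h2
      exact_mod_cast h2
    rw [Nat.mod_eq_of_lt h1] at hL
    have h3 : (N' : ℝ) ^ K * trunc N x L < ⌊(N' : ℚ) ^ K * trunc N x L⌋₊ + 1 := by
      exact_mod_cast Nat.lt_floor_add_one ((N' : ℚ) ^ K * trunc N x L)
    rw [← hL] at h3
    refine le_of_mul_le_mul_left ?_ (hpos K)
    rw [mul_sub, inv_pow, mul_inv_cancel₀ (hpos K).ne']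
    linarith
  have hgeom : Tendsto (fun K : ℕ => (ξ : ℝ) - ((N' : ℝ)⁻¹) ^ K) atTop (𝓝 (ξ : ℝ)) := by
    have := (tendsto_pow_atTop_nhds_zero_of_lt_one (r := (N' : ℝ)⁻¹) (by positivity)
      (inv_lt_one_of_one_lt₀ (Nat.one_lt_cast.2 hN'))).const_sub (ξ : ℝ)
    simpa using this
  have hfinal : Tendsto (fun K => (s' K : ℝ)) atTop (𝓝 (ξ : ℝ)) :=
    tendsto_of_tendsto_of_tendsto_of_le_of_le' hgeom tendsto_const_nhds hdown
      (Eventually.of_forall hup)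
  exact tendsto_nhds_unique hs'_lim (ENNReal.tendsto_coe.2 (NNReal.tendsto_coe.1 hfinal))

end MulCA

theorem mainTheorem2 (N₁ N₂ : ℕ) [NeZero N₂] (h₁ : 1 < N₁) (h₂ : 1 < N₂)
    (h : ∀ p : ℕ, p.Prime → p ∣ N₂ → p ∣ N₁) :
    (∀ α : ℝ, 0 < α → MulCA.MulDefined N₁ α → MulCA.MulDefined N₂ α →
      MulCA.IsFactorMap (MulCA.Mul N₁ α) (MulCA.Mul N₂ α) (MulCA.factMap N₁ N₂)) ∧
    (∀ x : MulCA.Config N₁, MulCA.realOf N₁ x ≠ ⊤ →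
      MulCA.realOf N₂ (MulCA.factMap N₁ N₂ x) = MulCA.realOf N₁ x) := by
  have : NeZero N₁ := ⟨by omega⟩
  have hs : MulCA.Smooth N₁ N₂ := MulCA.smooth_of_prime_dvd h
  refine ⟨fun α _ _ hα => ?_, MulCA.realOf_factMap hs h₂⟩
  obtain ⟨β, hβ, rfl⟩ := hα.exists_rat
  exact MulCA.isFactorMap_factMap hs hβ
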